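/- Let $d\in\{2,3\}$, $\ell>0$, $\Omega=(0,\ell)^d$, and let $(\cdot,\cdot)$, $\|\cdot\|$ be the inner product and norm of $L^2(\Omega)$. Let $H$ be the Hilbert space of mean-zero $\Omega$-periodic $H^1$ functions, that is, of all $v\in L^2(\Omega)$ with $\int_\Omega v=0$ that have weak derivatives $\partial_1v,\dots,\partial_dv\in L^2(\Omega)$ with $\int_\Omega v\,\partial_i\varphi=-\int_\Omega(\partial_iv)\,\varphi$ for all smooth $\varphi:\mathbb R^d\to\mathbb R$ that are $\ell$-periodic in each coordinate. Let $H^*$ be its dual, and regard $v\in H$ as the element $\psi\mapsto(v,\psi)$ of $H^*$. Let $M\in L^\infty(\Omega)$ with $0<M_1\le M\le M_2$ almost everywhere, $f\in L^2(\Omega)$, $u_\star\in H$, $\lambda>0$, $\gamma\ge0$ and $v_0\in H$. Define $-\Delta,\,-\Delta_M,\,\mathcal L:H\to H^*$ by $$\langle-\Delta v,\psi\rangle=(\nabla v,\nabla\psi),\qquad \langle-\Delta_Mv,\psi\rangle=(M\nabla v,\nabla\psi),\qquad \mathcal Lv=\lambda(-\Delta)^{-1}v+\gamma v-\Delta v,$$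 the norm $\|v\|_{\mathcal L}=\langle\mathcal Lv,v\rangle^{1/2}$, and the stationary Cahn–Hilliard energy with variable mobility $M$, $$G(v)=\tfrac12\big((-\Delta_M)^{-1}(v-u_\star),\,v-u_\star\big)+\tfrac14\|v\|_{L^4}^4+\tfrac12\|\nabla v\|^2-(f,v),\qquad v\in H.$$ For $\phi\in H^*$ and $\theta=(w_0,\tau,N)\in H\times(0,\infty)\times\mathbb N$, let $A(\phi;\theta)=w_N$ be the result of $N$ steps of the inner preconditioned gradient descent $w_{n+1}=w_n+\tau(-\Delta)^{-1}(\phi+\Delta_Mw_n)$ started at $w_0$. For a step size $s>0$ and parameters $(\tau_k,N_k)\in(0,\infty)\times\mathbb N$, the perturbed preconditioned gradient descent (PPGD) started at $v_0$ is $$v_{k+1}=v_k-s\,\mathcal L^{-1}\big(\delta G(v_k)+\eta_k\big),\qquad \eta_k=A(v_k-u_\star;\theta_k)-(-\Delta_M)^{-1}(v_k-u_\star),\qquad \theta_k=(v_k,\tau_k,N_k),$$ where $\delta G$ is the Fréchet derivative of $G$; thus $v_k$ itself is the initial guess of the inner solver. Then the operators $-\Delta$, $-\Delta_M$, $\mathcal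 L$ are isomorphisms, $H\subset L^4(\Omega)$, $G$ is Fréchet differentiable and has a unique minimizer $u\in H$, and PPGD converges to $u$ in the following sense: for every $\epsilon>0$ there is $s_0>0$ such that for every $s\in(0,s_0]$ there exist $\hat K\in\mathbb N$ and inner solver parameters $\{(\tau_k,N_k)\}_{k\ge0}\subset(0,\infty)\times\mathbb N$, with $N_k\ge1$, for which $$\|v_k-u\|_{\mathcal L}<\epsilon\qquad\text{for all } k\ge\hat K.$$ -/

import Mathlib

open MeasureTheory
open scoped ContDiff ENNReal

noncomputable section

namespace CahnHilliard

/-! ### The periodic cell and mean-zero periodic `H¹` -/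

/-- The cell `Ω = (0, ℓ)ᵈ`. -/
def cell (d : ℕ) (ℓ : ℝ) : Set (Fin d → ℝ) := Set.univ.pi fun _ => Set.Ioo 0 ℓ

/-- Lebesgue measure on the cell `Ω`. -/
abbrev cellMeasure (d : ℕ) (ℓ : ℝ) : Measure (Fin d → ℝ) := volume.restrict (cell d ℓ)

/-- `L²(Ω)`. -/
abbrev L2 (d : ℕ) (ℓ : ℝ) := Lp ℝ 2 (cellMeasure d ℓ)

/-- `L^∞(Ω)`. -/
abbrev Linf (d : ℕ) (ℓ : ℝ) := Lp ℝ ∞ (cellMeasure d ℓ)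

/-- Test functions: smooth functions on `ℝᵈ` that are `ℓ`-periodic in every coordinate. -/
def IsPeriodicTest {d : ℕ} (ℓ : ℝ) (φ : (Fin d → ℝ) → ℝ) : Prop :=
  ContDiff ℝ ∞ φ ∧ ∀ j, Function.Periodic φ (Pi.single j ℓ)

/-- `g` is the `i`-th weak partial derivative of `v` on the torus:
`∫_Ω v ∂ᵢφ = - ∫_Ω g φ` for all smooth periodic `φ`. The test functions do not vanish at the boundary
of the cell, so this says both that `v` is weakly differentiable in `Ω` and that its
traces on opposite faces agree. -/
def IsWeakPartial {d : ℕ} {ℓ : ℝ} (i : Fin d) (v g : L2 d ℓ) : Prop :=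
  ∀ φ : (Fin d → ℝ) → ℝ, IsPeriodicTest ℓ φ →
    ∫ x, v x * fderiv ℝ φ x (Pi.single i 1) ∂(cellMeasure d ℓ)
      = -∫ x, g x * φ x ∂(cellMeasure d ℓ)

lemma cell_subset (d : ℕ) (ℓ : ℝ) : cell d ℓ ⊆ Set.univ.pi fun _ => Set.Icc 0 ℓ :=
  Set.pi_mono fun _ _ => Set.Ioo_subset_Icc_self

lemma measurableSet_cell (d : ℕ) (ℓ : ℝ) : MeasurableSet (cell d ℓ) :=
  MeasurableSet.univ_pi fun _ => measurableSet_Ioo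

instance isFiniteMeasure_cellMeasure (d : ℕ) (ℓ : ℝ) : IsFiniteMeasure (cellMeasure d ℓ) :=
  ⟨by
    rw [Measure.restrict_apply_univ]
    exact (measure_mono (cell_subset d ℓ)).trans_lt
      (isCompact_univ_pi fun _ => isCompact_Icc).measure_lt_top⟩

lemma integrable_mul_of_continuous {d : ℕ} {ℓ : ℝ} (v : L2 d ℓ) {ψ : (Fin d → ℝ) → ℝ}
    (hψ : Continuous ψ) : Integrable (fun x => v x * ψ x) (cellMeasure d ℓ) := by
  obtain ⟨C, hC⟩ := (isCompact_univ_pi (fun _ : Fin d => isCompact_Icc (a := (0 : ℝ)) (b := ℓ))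
    ).exists_bound_of_continuousOn hψ.continuousOn
  refine ((Lp.memLp v).integrable one_le_two).mul_bdd (c := C) hψ.aestronglyMeasurable ?_
  filter_upwards [ae_restrict_mem (measurableSet_cell d ℓ)] with x hx
  exact hC x (cell_subset d ℓ hx)

lemma integral_add_mul {d : ℕ} {ℓ : ℝ} (v w : L2 d ℓ) {ψ : (Fin d → ℝ) → ℝ} (hψ : Continuous ψ) :
    ∫ x, (v + w : L2 d ℓ) x * ψ x ∂(cellMeasure d ℓ)
      = ∫ x, v x * ψ x ∂(cellMeasure d ℓ) + ∫ x, w x * ψ x ∂(cellMeasure d ℓ) := by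
  rw [← integral_add (integrable_mul_of_continuous v hψ) (integrable_mul_of_continuous w hψ)]
  refine integral_congr_ae ?_
  filter_upwards [Lp.coeFn_add v w] with x hx
  rw [hx, Pi.add_apply, add_mul]

lemma integral_smul_mul {d : ℕ} {ℓ : ℝ} (c : ℝ) (v : L2 d ℓ) (ψ : (Fin d → ℝ) → ℝ) :
    ∫ x, (c • v : L2 d ℓ) x * ψ x ∂(cellMeasure d ℓ)
      = c * ∫ x, v x * ψ x ∂(cellMeasure d ℓ) := by
  rw [← integral_const_mul]
  refine integral_congr_ae ?_
  filter_upwards [Lp.coeFn_smul c v] with x hx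
  rw [hx, Pi.smul_apply, smul_eq_mul, mul_assoc]

lemma integral_zero_mul {d : ℕ} {ℓ : ℝ} (ψ : (Fin d → ℝ) → ℝ) :
    ∫ x, (0 : L2 d ℓ) x * ψ x ∂(cellMeasure d ℓ) = 0 := by
  simpa using integral_smul_mul (0 : ℝ) (0 : L2 d ℓ) ψ

lemma IsPeriodicTest.continuous_fderiv {d : ℕ} {ℓ : ℝ} {φ : (Fin d → ℝ) → ℝ}
    (hφ : IsPeriodicTest ℓ φ) (e : Fin d → ℝ) : Continuous fun x => fderiv ℝ φ x e :=
  (hφ.1.continuous_fderiv (by simp)).clm_apply continuous_const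

/-- Mean-zero periodic `H¹`. An element is a function `v ∈ L²(Ω)` with zero mean together with its
weak gradient `(∂₁v, …, ∂_d v) ∈ L²(Ω)ᵈ`, which is determined by `v`. The norm inherited from the
`L²` product is the full `H¹` norm, `‖v‖² + ‖∇v‖²`. -/
def H1 (d : ℕ) (ℓ : ℝ) :
    Submodule ℝ (WithLp 2 (L2 d ℓ × PiLp 2 fun _ : Fin d => L2 d ℓ)) where
  carrier := {p | ∫ x, p.fst x ∂(cellMeasure d ℓ) = 0 ∧ ∀ i, IsWeakPartial i p.fst (p.snd i)}
  zero_mem' := by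
    refine ⟨by simpa using integral_zero_mul (d := d) (ℓ := ℓ) fun _ => 1, fun i φ _ => ?_⟩
    simp only [WithLp.zero_fst, WithLp.zero_snd, PiLp.zero_apply, integral_zero_mul, neg_zero]
  add_mem' := by
    rintro p q ⟨hp, hp'⟩ ⟨hq, hq'⟩
    refine ⟨?_, fun i φ hφ => ?_⟩
    · have h := integral_add_mul p.fst q.fst (ψ := fun _ => 1) continuous_const
      simp only [mul_one] at h
      rw [WithLp.add_fst, h, hp, hq, add_zero]
    · simp only [WithLp.add_fst, WithLp.add_snd, PiLp.add_apply]
      rw [integral_add_mul _ _ (hφ.continuous_fderiv _), integral_add_mul _ _ hφ.1.continuous,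
        hp' i φ hφ, hq' i φ hφ, neg_add]
  smul_mem' := by
    rintro c p ⟨hp, hp'⟩
    refine ⟨?_, fun i φ hφ => ?_⟩
    · have h := integral_smul_mul c p.fst fun _ => 1
      simp only [mul_one] at h
      rw [WithLp.smul_fst, h, hp, mul_zero]
    · simp only [WithLp.smul_fst, WithLp.smul_snd, PiLp.smul_apply]
      rw [integral_smul_mul, integral_smul_mul, hp' i φ hφ, mul_neg]

variable {d : ℕ} {ℓ : ℝ}

/-- The embedding of mean-zero periodic `H¹` into `L²(Ω)`. -/
def toL2 : H1 d ℓ →L[ℝ] L2 d ℓ :=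
  WithLp.fstL 2 ℝ (L2 d ℓ) (PiLp 2 fun _ : Fin d => L2 d ℓ) ∘L (H1 d ℓ).subtypeL

/-- The weak partial derivative `∂ᵢ`. -/
def partialDeriv (i : Fin d) : H1 d ℓ →L[ℝ] L2 d ℓ :=
  PiLp.proj 2 (fun _ : Fin d => L2 d ℓ) i ∘L
    WithLp.sndL 2 ℝ (L2 d ℓ) (PiLp 2 fun _ : Fin d => L2 d ℓ) ∘L (H1 d ℓ).subtypeL

/-! ### Operators from mean-zero periodic `H¹` to its dual -/

/-- The dual of mean-zero periodic `H¹`. -/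
abbrev Hneg (d : ℕ) (ℓ : ℝ) := StrongDual ℝ (H1 d ℓ)

/-- The Gelfand-triple identification of `v` with the functional `ψ ↦ (v, ψ)_{L²}`. -/
def gelfand : H1 d ℓ →L[ℝ] Hneg d ℓ := (innerSL ℝ).bilinearComp toL2 toL2

/-- `-Δ`, that is `⟨-Δ v, ψ⟩ = ∑ᵢ (∂ᵢ v, ∂ᵢ ψ)`. -/
def negLap : H1 d ℓ →L[ℝ] Hneg d ℓ :=
  ∑ i, (innerSL ℝ).bilinearComp (partialDeriv i) (partialDeriv i)

/-- Pointwise multiplication by `M ∈ L^∞(Ω)` on `L²(Ω)`. -/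
def mulBy (M : Linf d ℓ) : L2 d ℓ →L[ℝ] L2 d ℓ :=
  (ContinuousLinearMap.mul ℝ ℝ).holderL (cellMeasure d ℓ) ∞ 2 2 M

/-- `-Δ_M`, that is `⟨-Δ_M v, ψ⟩ = ∑ᵢ (M ∂ᵢ v, ∂ᵢ ψ)`. -/
def negLapM (M : Linf d ℓ) : H1 d ℓ →L[ℝ] Hneg d ℓ :=
  ∑ i, (innerSL ℝ).bilinearComp (mulBy M ∘L partialDeriv i) (partialDeriv i)

/-- The preconditioner `ℒ v = lam (-Δ)⁻¹ v + γ v - Δ v`. -/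
def precond (lam γ : ℝ) : H1 d ℓ →L[ℝ] Hneg d ℓ :=
  lam • (gelfand ∘L negLap.inverse ∘L gelfand) + γ • gelfand + negLap

/-- The norm `‖v‖_ℒ = ⟨ℒ v, v⟩^{1/2}`. -/
def normL (lam γ : ℝ) (v : H1 d ℓ) : ℝ := Real.sqrt (precond lam γ v v)

/-! ### The energy and the method -/

/-- The weighted dual norm `‖ψ‖ = ((-Δ_M)⁻¹ ψ, ψ)_{L²}^{1/2}`. -/
def normNegM (M : Linf d ℓ) (ψ : H1 d ℓ) : ℝ :=
  Real.sqrt (inner ℝ (toL2 ((negLapM M).inverse (gelfand ψ))) (toL2 ψ))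

/-- The stationary Cahn–Hilliard energy
`G(v) = ½ ‖v - u⋆‖²_{-1,M} + ¼ ‖v‖⁴_{L⁴} + ½ ‖∇v‖² - (f, v)`. -/
def energy (M : Linf d ℓ) (f : L2 d ℓ) (uStar v : H1 d ℓ) : ℝ :=
  1 / 2 * normNegM M (v - uStar) ^ 2 + 1 / 4 * ∫ x, |toL2 v x| ^ 4 ∂(cellMeasure d ℓ)
    + 1 / 2 * ∑ i, ‖partialDeriv i v‖ ^ 2 - inner ℝ f (toL2 v)

/-- The inner preconditioned gradient descent for `-Δ_M w = φ` with initial guess `w₀` and step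
size `τ`: `w_{n+1} = w_n + τ (-Δ)⁻¹ (φ + Δ_M w_n)`. -/
def innerPGD (M : Linf d ℓ) (φ : Hneg d ℓ) (w₀ : H1 d ℓ) (τ : ℝ) : ℕ → H1 d ℓ
  | 0 => w₀
  | n + 1 => innerPGD M φ w₀ τ n + τ • negLap.inverse (φ - negLapM M (innerPGD M φ w₀ τ n))

/-- The solver parameters `θ = (w₀, τ, N)`: initial guess, step size, number of iterations. -/
abbrev Param (d : ℕ) (ℓ : ℝ) := H1 d ℓ × ℝ × ℕ

/-- `A(φ; θ)`: the approximation of `(-Δ_M)⁻¹ φ` by the inner iteration with parameters `θ`. -/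
def approxInv (M : Linf d ℓ) (φ : Hneg d ℓ) (θ : Param d ℓ) : H1 d ℓ :=
  innerPGD M φ θ.1 θ.2.1 θ.2.2

/-- The perturbation `η = A(v - u⋆; θ) - (-Δ_M)⁻¹ (v - u⋆)`, as an element of the dual. -/
def perturbation (M : Linf d ℓ) (uStar v : H1 d ℓ) (θ : Param d ℓ) : Hneg d ℓ :=
  gelfand (approxInv M (gelfand (v - uStar)) θ - (negLapM M).inverse (gelfand (v - uStar)))

/-- The perturbed preconditioned gradient descent
`v_{k+1} = v_k - s ℒ⁻¹ (δG(v_k) + η_k)`, where `η_k` is the perturbation for the solver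
parameters `θ_k = (v_k, τ_k, N_k)`: the inner iteration starts from `v_k`. -/
def ppgd (M : Linf d ℓ) (f : L2 d ℓ) (uStar : H1 d ℓ) (lam γ s : ℝ) (v₀ : H1 d ℓ)
    (τ : ℕ → ℝ) (N : ℕ → ℕ) : ℕ → H1 d ℓ
  | 0 => v₀
  | k + 1 =>
    let v := ppgd M f uStar lam γ s v₀ τ N k
    v - s • (precond lam γ).inverse
      (fderiv ℝ (energy M f uStar) v + perturbation M uStar v (v, τ k, N k))

end CahnHilliard

end

open CahnHilliard

open MeasureTheory
open scoped ContDiff ENNReal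

noncomputable section

namespace CahnHilliard

/-! The energy is a nonnegative quadratic form of `v - uStar`, plus a convex quartic, plus `½‖∇v‖²`,
minus a linear term. By Poincaré the gradient term is coercive on the mean-zero space, so `G` is
strongly convex and its minimizing sequences are Cauchy: there is exactly one minimizer `u`, and
`δG(u) = 0`. The gradient is cubic, hence Lipschitz on bounded sets only.

Both loops rest on one identity. For symmetric coercive `P`, the squared `P`-norm of `e - s P⁻¹ g`
is `⟨Pe, e⟩ - 2s g(e) + s² g(P⁻¹ g)`; strong monotonicity bounds `g(e)` below, a Lipschitz bound
controls the last term, and small `s` gives a contraction (`exists_energy_contraction`). With `P =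
-Δ`, `g = -Δ_M e` the inner iteration converges for a fixed `τ` (`exists_richardson_step`), so at
each iterate enough inner steps make `η` as small as desired. With `P = ℒ`, `g = δG(v)` the outer
step contracts up to that perturbation: the squared error obeys `E (k+1) ≤ (1 - t) E k + t ρ`, which
keeps the iterates in the ball where the Lipschitz constant was taken and brings `E` below `ε²`
(`exists_perturbed_descent_converges`).

The analytic inputs, Poincaré and `H¹ ⊂ L⁴`, come from Fourier series on the torus. The square of a
trigonometric polynomial has the self-convolution as coefficients, and weighted Cauchy–Schwarz
bounds it using `∑ (1 + |n|²)⁻² < ∞`, true for `d < 4`; Fatou's lemma passes to the limit. -/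

open Filter Topology

/-! ### Strong convexity and perturbed descent in a Hilbert space -/

section Abstract

variable {V : Type*} [NormedAddCommGroup V] [InnerProductSpace ℝ V]

/-- The Lax–Milgram theorem for operators into the dual. -/
lemma isInvertible_of_coercive [CompleteSpace V] {A : V →L[ℝ] StrongDual ℝ V} {c : ℝ} (hc : 0 < c)
    (h : ∀ v, c * ‖v‖ ^ 2 ≤ A v v) : A.IsInvertible := by
  have hA : IsCoercive A := ⟨c, hc, fun v => by simpa [pow_two, mul_assoc] using h v⟩
  refine ⟨hA.continuousLinearEquivOfBilin.trans
    (InnerProductSpace.toDual ℝ V).toContinuousLinearEquiv, ?_⟩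
  ext v w
  simp

/-- One step of preconditioned gradient descent contracts the energy of the preconditioner. -/
lemma exists_energy_contraction [CompleteSpace V] {P : V →L[ℝ] StrongDual ℝ V} {c : ℝ} (hc : 0 < c)
    (hP : ∀ v, c * ‖v‖ ^ 2 ≤ P v v) (hsymm : ∀ v w, P v w = P w v) {m K : ℝ} (hm : 0 < m) :
    ∃ κ > 0, ∃ s₀ > 0, ∀ s, 0 < s → s ≤ s₀ → s * κ ≤ 1 ∧ ∀ (e : V) (g : StrongDual ℝ V),
      m * ‖e‖ ^ 2 ≤ g e → ‖g‖ ≤ K * ‖e‖ →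
        P (e - s • P.inverse g) (e - s • P.inverse g) ≤ (1 - s * κ) * P e e := by
  have hinv := isInvertible_of_coercive hc hP
  have hκ : 0 < m / (‖P‖ + 1) := by positivity
  -- The first bound on `s` lets half of the gain `2s g(e)` absorb the quadratic term; the other
  -- half, at least `s m ‖e‖²`, dominates `s κ ⟨Pe, e⟩`. The second bound keeps the factor `1 - s κ`
  -- nonnegative. The added ones avoid division by zero.
  refine ⟨m / (‖P‖ + 1), hκ, min (m / (‖P.inverse‖ * K ^ 2 + 1)) (1 / (m / (‖P‖ + 1))), by positivity,
    fun s hs hs₀ => ⟨?_, fun e g hge hg => ?_⟩⟩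
  · have := hs₀.trans (min_le_right _ _)
    rwa [le_div_iff₀ hκ] at this
  have hs1 : s * (‖P.inverse‖ * K ^ 2 + 1) ≤ m := by
    have := hs₀.trans (min_le_left _ _)
    rwa [le_div_iff₀ (by positivity)] at this
  have h1 : P (P.inverse g) = g := hinv.self_apply_inverse g
  have h2 : P e (P.inverse g) = g e := by rw [hsymm, h1]
  have h3 : g (P.inverse g) ≤ ‖P.inverse‖ * K ^ 2 * ‖e‖ ^ 2 := by
    calc g (P.inverse g) ≤ ‖g‖ * ‖P.inverse g‖ := (le_abs_self _).trans (g.le_opNorm _)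
      _ ≤ ‖g‖ * (‖P.inverse‖ * ‖g‖) := by gcongr; exact P.inverse.le_opNorm g
      _ = ‖P.inverse‖ * ‖g‖ ^ 2 := by ring
      _ ≤ ‖P.inverse‖ * (K * ‖e‖) ^ 2 := by gcongr
      _ = _ := by ring
  have h4 : P (e - s • P.inverse g) (e - s • P.inverse g)
      = P e e - 2 * s * g e + s ^ 2 * g (P.inverse g) := by
    simp only [map_sub, map_smul, sub_apply, smul_apply, smul_eq_mul, h1, h2]
    ring
  have h5 : P e e ≤ (‖P‖ + 1) * ‖e‖ ^ 2 := by
    have : P e e ≤ ‖P‖ * ‖e‖ * ‖e‖ := (le_abs_self _).trans (P.le_opNorm₂ e e)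
    nlinarith [sq_nonneg ‖e‖]
  have h6 : m / (‖P‖ + 1) * P e e ≤ m * ‖e‖ ^ 2 := by
    calc m / (‖P‖ + 1) * P e e ≤ m / (‖P‖ + 1) * ((‖P‖ + 1) * ‖e‖ ^ 2) := by gcongr
      _ = _ := by field_simp
  rw [h4]
  have h7 : s ^ 2 * g (P.inverse g) ≤ s * (m * ‖e‖ ^ 2) := by
    calc s ^ 2 * g (P.inverse g) ≤ s ^ 2 * (‖P.inverse‖ * K ^ 2 * ‖e‖ ^ 2) := by gcongr
      _ = s * (s * (‖P.inverse‖ * K ^ 2) * ‖e‖ ^ 2) := by ring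
      _ ≤ s * (m * ‖e‖ ^ 2) := by gcongr; nlinarith
  nlinarith

/-- A bounded-below function whose midpoint convexity has a quadratic modulus attains its infimum. -/
lemma exists_unique_minimizer [CompleteSpace V] {G : V → ℝ} (hG : Continuous G) {c : ℝ} (hc : 0 < c)
    (hmid : ∀ p q, 2 * G ((1 / 2 : ℝ) • (p + q)) + c * ‖p - q‖ ^ 2 ≤ G p + G q)
    (hbdd : BddBelow (Set.range G)) :
    ∃ u, (∀ v, G u ≤ G v) ∧ ∀ u', (∀ v, G u' ≤ G v) → u' = u := by
  set I := ⨅ v, G v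
  have hI : ∀ v, I ≤ G v := fun v => ciInf_le hbdd v
  have hex : ∀ n : ℕ, ∃ v, G v < I + 1 / (n + 1) := fun n =>
    exists_lt_of_ciInf_lt (lt_add_of_pos_right I (by positivity))
  choose w hw using hex
  -- The midpoint of two almost minimizers still has energy at least `I`, so the convexity modulus
  -- bounds their distance.
  have hdist : ∀ N m n : ℕ, N ≤ m → N ≤ n → c * ‖w m - w n‖ ^ 2 ≤ 2 * (1 / ((N : ℝ) + 1)) := by
    intro N m n hm hn
    have h1 := hmid (w m) (w n)
    have h2 := hI ((1 / 2 : ℝ) • (w m + w n))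
    have h3 : (1 : ℝ) / (m + 1) ≤ 1 / (N + 1) := by gcongr
    have h4 : (1 : ℝ) / (n + 1) ≤ 1 / (N + 1) := by gcongr
    linarith [hw m, hw n]
  have hcauchy : CauchySeq w := by
    refine cauchySeq_of_le_tendsto_0 (fun N : ℕ => Real.sqrt (2 * (1 / ((N : ℝ) + 1)) / c)) ?_ ?_
    · intro m n N hm hn
      rw [dist_eq_norm]
      refine Real.le_sqrt_of_sq_le ?_
      rw [le_div_iff₀ hc, mul_comm]
      exact hdist N m n hm hn
    · have h := ((tendsto_one_div_add_atTop_nhds_zero_nat (𝕜 := ℝ)).const_mul 2).div_const c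
      simpa [Function.comp_def] using (Real.continuous_sqrt.tendsto _).comp h
  obtain ⟨u, hu⟩ := cauchySeq_tendsto_of_complete hcauchy
  have hGu : G u ≤ I := by
    refine le_of_tendsto_of_tendsto' ((hG.tendsto u).comp hu) ?_ fun n => (hw n).le
    simpa using (tendsto_one_div_add_atTop_nhds_zero_nat (𝕜 := ℝ)).const_add I
  have hmin : ∀ v, G u ≤ G v := fun v => hGu.trans (hI v)
  refine ⟨u, hmin, fun u' hu' => ?_⟩
  have h1 := hmid u' u
  have h2 := hu' ((1 / 2 : ℝ) • (u' + u))
  have h3 := hmin ((1 / 2 : ℝ) • (u' + u))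
  have h4 : ‖u' - u‖ ^ 2 ≤ 0 := by
    by_contra! h
    nlinarith [mul_pos hc h]
  simpa [sub_eq_zero] using le_antisymm h4 (sq_nonneg _)

/-- The first-order form of strong convexity with modulus `c`. -/
def StronglyAbove (G : V → ℝ) (G' : V → StrongDual ℝ V) (c : ℝ) : Prop :=
  ∀ a b, G a + G' a (b - a) + c * ‖b - a‖ ^ 2 ≤ G b

/-- Tangent inequalities at the midpoint, added for the two endpoints, lose their linear terms and
leave the modulus `2c · ¼ = c / 2`. The tangent inequality at `0`, after completing the square,
bounds `G` below. -/
lemma StronglyAbove.exists_unique_minimizer [CompleteSpace V] {G : V → ℝ} {G' : V → StrongDual ℝ V} {c : ℝ}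
    (h : StronglyAbove G G' c) (hG : Continuous G) (hc : 0 < c) :
    ∃ u, (∀ v, G u ≤ G v) ∧ ∀ u', (∀ v, G u' ≤ G v) → u' = u := by
  refine CahnHilliard.exists_unique_minimizer (c := c / 2) hG (by positivity) (fun p q => ?_)
    ⟨G 0 - ‖G' 0‖ ^ 2 / (4 * c), ?_⟩
  · have h1 := h ((1 / 2 : ℝ) • (p + q)) p
    have h2 := h ((1 / 2 : ℝ) • (p + q)) q
    have e1 : p - (1 / 2 : ℝ) • (p + q) = (1 / 2 : ℝ) • (p - q) := by module
    have e2 : q - (1 / 2 : ℝ) • (p + q) = -((1 / 2 : ℝ) • (p - q)) := by module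
    rw [e1, norm_smul] at h1
    rw [e2, norm_neg, norm_smul, map_neg] at h2
    norm_num at h1 h2 ⊢
    nlinarith
  · rintro _ ⟨v, rfl⟩
    have h1 := h 0 v
    have h2 : -(‖G' 0‖ * ‖v‖) ≤ G' 0 v := neg_le_of_abs_le ((G' 0).le_opNorm v)
    rw [sub_zero] at h1
    have h3 : ‖G' 0‖ * ‖v‖ ≤ c * ‖v‖ ^ 2 + ‖G' 0‖ ^ 2 / (4 * c) := by
      have : c * ‖v‖ ^ 2 + ‖G' 0‖ ^ 2 / (4 * c) - ‖G' 0‖ * ‖v‖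
        = (2 * c * ‖v‖ - ‖G' 0‖) ^ 2 / (4 * c) := by field_simp; ring
      nlinarith [show 0 ≤ (2 * c * ‖v‖ - ‖G' 0‖) ^ 2 / (4 * c) by positivity]
    linarith

lemma StronglyAbove.monotone {G : V → ℝ} {G' : V → StrongDual ℝ V} {c : ℝ}
    (h : StronglyAbove G G' c) (a b : V) : 2 * c * ‖b - a‖ ^ 2 ≤ (G' b - G' a) (b - a) := by
  have h1 := h a b
  have h2 := h b a
  rw [← neg_sub b a, norm_neg, map_neg] at h2
  rw [sub_apply]
  linarith

/-- Geometric decay up to a threshold. -/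
lemma eventually_lt_of_affine_recursion {E : ℕ → ℝ} {t ρ ρ' : ℝ} (ht : 0 < t) (ht1 : t ≤ 1)
    (hρ : ρ < ρ') (hE : ∀ k, E (k + 1) ≤ (1 - t) * E k + t * ρ) :
    ∃ K, ∀ k ≥ K, E k < ρ' := by
  have hpow : ∀ k, E k - ρ ≤ (1 - t) ^ k * |E 0 - ρ| := by
    intro k
    induction k with
    | zero => simpa using le_abs_self (E 0 - ρ)
    | succ k ih =>
      have := mul_le_mul_of_nonneg_left ih (by linarith : (0 : ℝ) ≤ 1 - t)
      rw [pow_succ]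
      nlinarith [hE k]
  have hlim : Tendsto (fun k : ℕ => (1 - t) ^ k * |E 0 - ρ|) atTop (𝓝 (0 * |E 0 - ρ|)) :=
    (tendsto_pow_atTop_nhds_zero_of_lt_one (by linarith) (by linarith)).mul_const _
  rw [zero_mul] at hlim
  obtain ⟨K, hK⟩ := eventually_atTop.1 (hlim.eventually_lt_const (sub_pos.2 hρ))
  exact ⟨K, fun k hk => by linarith [hpow k, hK k hk]⟩

/-- For a symmetric coercive preconditioner and a coercive operator, the
preconditioned Richardson iteration converges for some step size. -/
lemma exists_richardson_step [CompleteSpace V] {P A : V →L[ℝ] StrongDual ℝ V} {c m : ℝ} (hc : 0 < c)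
    (hP : ∀ v, c * ‖v‖ ^ 2 ≤ P v v) (hsymm : ∀ v w, P v w = P w v) (hm : 0 < m)
    (hA : ∀ v, m * ‖v‖ ^ 2 ≤ A v v) :
    ∃ τ : ℝ, 0 < τ ∧ ∀ (φ : StrongDual ℝ V) (w : ℕ → V),
      (∀ n, w (n + 1) = w n + τ • P.inverse (φ - A (w n))) →
        Tendsto w atTop (𝓝 (A.inverse φ)) := by
  -- Here the gradient is `A e`, for the error `e`. Linearity makes the Lipschitz bound global, so
  -- the step depends neither on `φ` nor on the starting point.
  obtain ⟨κ, hκ, s₀, hs₀, h⟩ := exists_energy_contraction (K := ‖A‖) hc hP hsymm hm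
  obtain ⟨hτ, hstep⟩ := h s₀ hs₀ le_rfl
  refine ⟨s₀, hs₀, fun φ w hw => ?_⟩
  have hinv := isInvertible_of_coercive hm hA
  set x := A.inverse φ
  have hx : A x = φ := hinv.self_apply_inverse φ
  have hrec : ∀ n, P (w (n + 1) - x) (w (n + 1) - x)
      ≤ (1 - s₀ * κ) * P (w n - x) (w n - x) + s₀ * κ * 0 := by
    intro n
    have := hstep (w n - x) (A (w n - x)) (hA _) (A.le_opNorm _)
    have e : w (n + 1) - x = w n - x - s₀ • P.inverse (A (w n - x)) := by
      rw [hw, ← hx, ← map_sub A, ← neg_sub (w n) x, map_neg, map_neg, smul_neg]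
      abel
    rw [e]
    simpa using this
  rw [Metric.tendsto_atTop]
  intro ε hε
  obtain ⟨N, hN⟩ := eventually_lt_of_affine_recursion (E := fun n => P (w n - x) (w n - x))
    (by positivity) hτ (show (0 : ℝ) < c * ε ^ 2 by positivity) hrec
  refine ⟨N, fun n hn => ?_⟩
  rw [dist_eq_norm]
  have h1 := (hP (w n - x)).trans_lt (hN n hn)
  exact lt_of_pow_lt_pow_left₀ 2 hε.le (lt_of_mul_lt_mul_left h1 hc.le)

/-- Perturbed preconditioned gradient descent for a strongly convex energy whose gradient is
Lipschitz on bounded sets, when the perturbations may be made as small as one likes. -/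
lemma exists_perturbed_descent_converges [CompleteSpace V] {G : V → ℝ} {G' : V → StrongDual ℝ V} {c c' : ℝ}
    (hG : StronglyAbove G G' c') (hc' : 0 < c') {P : V →L[ℝ] StrongDual ℝ V} (hc : 0 < c)
    (hP : ∀ v, c * ‖v‖ ^ 2 ≤ P v v) (hsymm : ∀ v w, P v w = P w v) {u : V} (hu : G' u = 0)
    (hLip : ∀ R, ∃ K, ∀ v, ‖v - u‖ ≤ R → ‖G' v‖ ≤ K * ‖v - u‖) (v₀ : V) {ε : ℝ} (hε : 0 < ε) :
    ∃ s₀ : ℝ, 0 < s₀ ∧ ∀ s : ℝ, 0 < s → s ≤ s₀ → ∃ δ : ℝ, 0 < δ ∧ ∀ v : ℕ → V, v 0 = v₀ →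
      (∀ k, ∃ η : StrongDual ℝ V, ‖η‖ ≤ δ ∧ v (k + 1) = v k - s • P.inverse (G' (v k) + η)) →
        ∃ K, ∀ k ≥ K, Real.sqrt (P (v k - u) (v k - u)) < ε := by
  have hPnn : ∀ v, 0 ≤ P v v := fun v => (by positivity : (0 : ℝ) ≤ c * ‖v‖ ^ 2).trans (hP v)
  -- The `P`-ball of squared radius `R2` about `u` contains `v₀`, and no iterate will leave it. The
  -- Lipschitz constant, and with it `s₀`, can therefore be fixed in advance.
  set R2 : ℝ := P (v₀ - u) (v₀ - u) + 1
  have hR2 : 0 < R2 := by have := hPnn (v₀ - u); positivity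
  obtain ⟨K, hK⟩ := hLip (Real.sqrt (R2 / c))
  obtain ⟨κ, hκ, s₀, hs₀, h⟩ :=
    exists_energy_contraction (m := 2 * c') (K := K) hc hP hsymm (by positivity)
  refine ⟨s₀, hs₀, fun s hs hss => ?_⟩
  obtain ⟨hsκ, hstep⟩ := h s hs hss
  have hinv := isInvertible_of_coercive hc hP
  -- Half of the contraction rate is given up to Young's inequality with parameter `t`: `(1 + t)(1 -
  -- 2t) ≤ 1 - t`.
  set t := s * κ / 2 with ht
  have htpos : 0 < t := by positivity
  -- The limiting error level `ρ` must not exceed `R2`, for the ball to be invariant, and must be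
  -- below `ε²`, for the conclusion.
  set ρ := min R2 (ε ^ 2 / 2)
  have hρ : 0 < ρ := by positivity
  set D := (1 + 1 / t) * s ^ 2 * (‖P.inverse‖ + 1) with hD
  have hDpos : 0 < D := by positivity
  -- With this `δ`, the perturbation contributes at most `t * ρ` after Young's inequality.
  refine ⟨Real.sqrt (t * ρ / D), by positivity, fun v hv0 hv => ?_⟩
  have hsplit : ∀ x y, P (x - y) (x - y) ≤ (1 + t) * P x x + (1 + 1 / t) * P y y := by
    intro x y
    -- Young's inequality for the form `P`: expand this square and divide by `t`.
    have h0 := hPnn (t • x + y)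
    simp only [map_add, map_smul, add_apply, smul_apply, smul_eq_mul, hsymm y x] at h0
    simp only [map_sub, sub_apply, hsymm y x]
    have h1 : 0 ≤ (t * (t * P x x + P x y) + (t * P x y + P y y)) / t :=
      div_nonneg (by linarith) htpos.le
    have h2 : (t * (t * P x x + P x y) + (t * P x y + P y y)) / t
        = t * P x x + 2 * P x y + 1 / t * P y y := by field_simp; ring
    rw [h2] at h1
    linarith
  have hrec : ∀ k, P (v k - u) (v k - u) ≤ R2 → P (v (k + 1) - u) (v (k + 1) - u)
      ≤ (1 - t) * P (v k - u) (v k - u) + t * ρ := by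
    intro k hk
    obtain ⟨η, hη, hvk⟩ := hv k
    have hnorm : ‖v k - u‖ ≤ Real.sqrt (R2 / c) := by
      refine Real.le_sqrt_of_sq_le ?_
      rw [le_div_iff₀ hc, mul_comm]
      exact (hP _).trans hk
    have hmono := hG.monotone u (v k)
    rw [hu, sub_zero] at hmono
    have h1 := hstep (v k - u) (G' (v k)) hmono (hK _ hnorm)
    have e : v (k + 1) - u = (v k - u - s • P.inverse (G' (v k))) - s • P.inverse η := by
      rw [hvk, map_add, smul_add]; abel
    have h2 : P (s • P.inverse η) (s • P.inverse η) ≤ s ^ 2 * (‖P.inverse‖ + 1) * (t * ρ / D) := by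
      have h3 : η (P.inverse η) ≤ (‖P.inverse‖ + 1) * ‖η‖ ^ 2 := by
        calc η (P.inverse η) ≤ ‖η‖ * ‖P.inverse η‖ := (le_abs_self _).trans (η.le_opNorm _)
          _ ≤ ‖η‖ * (‖P.inverse‖ * ‖η‖) := by gcongr; exact P.inverse.le_opNorm η
          _ ≤ _ := by nlinarith [sq_nonneg ‖η‖]
      have h4 : ‖η‖ ^ 2 ≤ t * ρ / D := by
        rw [← Real.sq_sqrt (show 0 ≤ t * ρ / D by positivity)]
        gcongr
      simp only [map_smul, smul_apply, smul_eq_mul, hinv.self_apply_inverse]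
      calc s * (s * η (P.inverse η)) = s ^ 2 * η (P.inverse η) := by ring
        _ ≤ s ^ 2 * ((‖P.inverse‖ + 1) * (t * ρ / D)) := by
          gcongr; exact h3.trans (by gcongr)
        _ = _ := by ring
    have h5 : (1 + 1 / t) * (s ^ 2 * (‖P.inverse‖ + 1) * (t * ρ / D)) = t * ρ := by
      rw [hD]; field_simp
    have h6 : (1 + t) * (1 - s * κ) ≤ 1 - t := by rw [ht]; nlinarith [mul_pos hs hκ]
    rw [e]
    calc _ ≤ (1 + t) * _ + (1 + 1 / t) * _ := hsplit _ _
      _ ≤ (1 + t) * ((1 - s * κ) * P (v k - u) (v k - u))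
          + (1 + 1 / t) * (s ^ 2 * (‖P.inverse‖ + 1) * (t * ρ / D)) := by gcongr
      _ = (1 + t) * (1 - s * κ) * P (v k - u) (v k - u) + t * ρ := by rw [h5]; ring
      _ ≤ _ := by gcongr; exact hPnn _
  have hball : ∀ k, P (v k - u) (v k - u) ≤ R2 := by
    intro k
    induction k with
    | zero => rw [hv0]; simp [R2]
    | succ k ih =>
      have h1 : t * ρ ≤ t * R2 := by gcongr; exact min_le_left _ _
      have h2 : (1 - t) * P (v k - u) (v k - u) ≤ (1 - t) * R2 := by
        have : 0 ≤ 1 - t := by rw [ht]; linarith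
        gcongr
      linarith [hrec k ih]
  obtain ⟨N, hN⟩ := eventually_lt_of_affine_recursion (E := fun k => P (v k - u) (v k - u))
    (ρ' := ε ^ 2) htpos (by rw [ht]; linarith)
    ((min_le_right _ _).trans_lt (by nlinarith [pow_pos hε 2])) fun k => hrec k (hball k)
  exact ⟨N, fun k hk => (Real.sqrt_lt' hε).2 (hN k hk)⟩

end Abstract

/-! ### The `L⁴` bound by Fourier series on the unit torus -/

section Torus

open UnitAddTorus

attribute [local instance] instMeasureSpaceUnitAddCircle

lemma isProbabilityMeasure_unitAddCircle :
    IsProbabilityMeasure (volume : Measure UnitAddCircle) :=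
  inferInstanceAs (IsProbabilityMeasure AddCircle.haarAddCircle)

attribute [local instance] isProbabilityMeasure_unitAddCircle

/-- A weighted Young inequality for the convolution of a finitely supported sequence with itself. -/
lemma sum_norm_convolution_sq_le {ι : Type*} [AddCommGroup ι] [DecidableEq ι] (F K : Finset ι)
    (hK : ∀ p ∈ F ×ˢ F, p.1 + p.2 ∈ K) (c : ι → ℂ) (w : ι → ℝ) (hw : ∀ n, 0 < w n) {W : ℝ}
    (hW : ∑ n ∈ F, (w n ^ 2)⁻¹ ≤ W) :
    ∑ k ∈ K, ‖∑ p ∈ F ×ˢ F with p.1 + p.2 = k, c p.1 * c p.2‖ ^ 2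
      ≤ W * (∑ n ∈ F, w n * ‖c n‖ ^ 2) ^ 2 := by
  -- On the fibre over `k` each entry of the pair determines the other. After the
  -- arithmetic–geometric mean inequality the sum thus splits into two sums over subsets of `F`.
  have hweights : ∀ k, ∑ p ∈ F ×ˢ F with p.1 + p.2 = k, (w p.1 * w p.2)⁻¹ ≤ W := by
    intro k
    have h1 : ∑ p ∈ F ×ˢ F with p.1 + p.2 = k, (w p.1 ^ 2)⁻¹ ≤ W := by
      rw [← Finset.sum_image (f := fun n => (w n ^ 2)⁻¹) (g := Prod.fst)]
      · refine (Finset.sum_le_sum_of_subset_of_nonneg ?_ fun n _ _ => by positivity).trans hW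
        intro n hn
        simp only [Finset.mem_image, Finset.mem_filter, Finset.mem_product] at hn
        obtain ⟨p, ⟨⟨hp, -⟩, -⟩, rfl⟩ := hn
        exact hp
      · rintro ⟨a, b⟩ hp ⟨a', b'⟩ hq (rfl : a = a')
        simp only [Finset.coe_filter, Set.mem_ofPred_eq] at hp hq
        exact Prod.ext rfl (add_left_cancel (hp.2.trans hq.2.symm))
    have h2 : ∑ p ∈ F ×ˢ F with p.1 + p.2 = k, (w p.2 ^ 2)⁻¹ ≤ W := by
      rw [← Finset.sum_image (f := fun n => (w n ^ 2)⁻¹) (g := Prod.snd)]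
      · refine (Finset.sum_le_sum_of_subset_of_nonneg ?_ fun n _ _ => by positivity).trans hW
        intro n hn
        simp only [Finset.mem_image, Finset.mem_filter, Finset.mem_product] at hn
        obtain ⟨p, ⟨⟨-, hp⟩, -⟩, rfl⟩ := hn
        exact hp
      · rintro ⟨a, b⟩ hp ⟨a', b'⟩ hq (rfl : b = b')
        simp only [Finset.coe_filter, Set.mem_ofPred_eq] at hp hq
        exact Prod.ext (add_right_cancel (hp.2.trans hq.2.symm)) rfl
    have h3 : ∀ p : ι × ι, (w p.1 * w p.2)⁻¹ ≤ 1 / 2 * (w p.1 ^ 2)⁻¹ + 1 / 2 * (w p.2 ^ 2)⁻¹ := by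
      intro p
      rw [mul_inv, ← inv_pow, ← inv_pow]
      nlinarith [sq_nonneg ((w p.1)⁻¹ - (w p.2)⁻¹)]
    calc _ ≤ ∑ p ∈ F ×ˢ F with p.1 + p.2 = k,
          (1 / 2 * (w p.1 ^ 2)⁻¹ + 1 / 2 * (w p.2 ^ 2)⁻¹) := Finset.sum_le_sum fun p _ => h3 p
      _ ≤ W := by
        rw [Finset.sum_add_distrib, ← Finset.mul_sum, ← Finset.mul_sum]
        linarith
  -- Cauchy–Schwarz, with the weight `w p.1 * w p.2` inserted and removed.
  have hterm : ∀ k, ‖∑ p ∈ F ×ˢ F with p.1 + p.2 = k, c p.1 * c p.2‖ ^ 2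
      ≤ (∑ p ∈ F ×ˢ F with p.1 + p.2 = k, (w p.1 * ‖c p.1‖ ^ 2) * (w p.2 * ‖c p.2‖ ^ 2)) * W := by
    intro k
    calc _ ≤ (∑ p ∈ F ×ˢ F with p.1 + p.2 = k, ‖c p.1‖ * ‖c p.2‖) ^ 2 := by
          gcongr
          exact (norm_sum_le _ _).trans_eq (by simp)
      _ ≤ (∑ p ∈ F ×ˢ F with p.1 + p.2 = k, (w p.1 * ‖c p.1‖ ^ 2) * (w p.2 * ‖c p.2‖ ^ 2)) *
          ∑ p ∈ F ×ˢ F with p.1 + p.2 = k, (w p.1 * w p.2)⁻¹ := by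
        refine Finset.sum_sq_le_sum_mul_sum_of_sq_le_mul _ (fun p _ => ?_) (fun p _ => ?_)
          fun p _ => le_of_eq ?_
        · have := hw p.1; have := hw p.2; positivity
        · have := hw p.1; have := hw p.2; positivity
        · have := (hw p.1).ne'; have := (hw p.2).ne'; field_simp
      _ ≤ _ := by
        gcongr
        · exact Finset.sum_nonneg fun p _ => by have := hw p.1; have := hw p.2; positivity
        · exact hweights k
  calc _ ≤ ∑ k ∈ K, (∑ p ∈ F ×ˢ F with p.1 + p.2 = k,
        (w p.1 * ‖c p.1‖ ^ 2) * (w p.2 * ‖c p.2‖ ^ 2)) * W := Finset.sum_le_sum fun k _ => hterm k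
    _ = _ := by
      rw [← Finset.sum_mul, Finset.sum_fiberwise_of_maps_to hK, Finset.sum_product,
        pow_two, Finset.sum_mul_sum, mul_comm]

/-- `∑ₙ (1 + |n|²)⁻² < ∞` over `ℤᵈ` for `d < 4`. -/
lemma summable_inv_one_add_sq_sq {d : ℕ} (hd : d < 4) :
    Summable fun n : Fin d → ℤ => ((1 + ∑ i, (n i : ℝ) ^ 2) ^ 2)⁻¹ := by
  let b := (Pi.basisFun ℝ (Fin d)).restrictScalars ℤ
  -- The dimension restriction enters here: `∑ ‖n‖⁻⁴` over a lattice converges when its rank is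
  -- below `4`. The sup norm satisfies `‖n‖² ≤ 1 + |n|²`.
  have hfin : Module.finrank ℤ (Submodule.span ℤ (Set.range (Pi.basisFun ℝ (Fin d)))) < 4 := by
    rw [Module.finrank_eq_card_basis b]; simpa using hd
  have h := ZLattice.summable_norm_pow_inv _ 4 hfin
  have h' := (b.equivFun.symm.toEquiv.summable_iff).2 h
  refine Summable.of_norm_bounded_eventually h' ?_
  filter_upwards [(Set.finite_singleton (0 : Fin d → ℤ)).compl_mem_cofinite] with n hn
  have hcoe : ((b.equivFun.symm n : Submodule.span ℤ (Set.range (Pi.basisFun ℝ (Fin d)))) :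
      Fin d → ℝ) = fun i => (n i : ℝ) := by
    rw [Module.Basis.equivFun_symm_apply]
    ext j
    simp [b, Finset.sum_apply, Pi.single_apply]
  have hnorm : ‖b.equivFun.symm n‖ = ‖fun i => (n i : ℝ)‖ := by
    rw [← hcoe]; rfl
  have hpos : 0 < ‖fun i => (n i : ℝ)‖ := by
    rw [norm_pos_iff]
    intro h0
    refine hn ?_
    ext i
    simpa using congrFun h0 i
  simp only [Function.comp, LinearEquiv.coe_toEquiv]
  rw [hnorm, norm_inv, norm_pow, inv_pow]
  have hle : ‖fun i => (n i : ℝ)‖ ^ 2 ≤ 1 + ∑ i, (n i : ℝ) ^ 2 := by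
    have hs : ∀ i, |(n i : ℝ)| ^ 2 ≤ 1 + ∑ i, (n i : ℝ) ^ 2 := fun i => by
      rw [sq_abs]
      have := Finset.single_le_sum (f := fun i => (n i : ℝ) ^ 2) (fun i _ => sq_nonneg _)
        (Finset.mem_univ i)
      linarith
    have h0 : 0 ≤ 1 + ∑ i, (n i : ℝ) ^ 2 := by positivity
    refine (Real.le_sqrt' hpos).1 ((pi_norm_le_iff_of_nonneg (Real.sqrt_nonneg _)).2 fun i => ?_)
    exact Real.le_sqrt_of_sq_le (hs i)
  have h4 : ‖fun i => (n i : ℝ)‖ ^ 4 = (‖fun i => (n i : ℝ)‖ ^ 2) ^ 2 := by ring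
  rw [h4, Real.norm_of_nonneg (show 0 ≤ 1 + ∑ i, (n i : ℝ) ^ 2 by positivity)]
  gcongr

variable {d : ℕ}

lemma integral_norm_sum_mFourier_sq (K : Finset (Fin d → ℤ)) (a : (Fin d → ℤ) → ℂ) :
    ∫ t, ‖(∑ n ∈ K, a n • mFourier n : C(UnitAddTorus (Fin d), ℂ)) t‖ ^ 2
      = ∑ n ∈ K, ‖a n‖ ^ 2 := by
  have h1 := (orthonormal_mFourier (d := Fin d)).inner_sum a a K
  simp only [mFourierLp, ← map_smul, ← map_sum] at h1
  rw [ContinuousMap.inner_toLp] at h1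
  simp only [RCLike.mul_conj, RCLike.conj_mul] at h1
  have h2 : ((∫ t, ‖(∑ n ∈ K, a n • mFourier n : C(UnitAddTorus (Fin d), ℂ)) t‖ ^ 2 : ℝ) : ℂ)
      = ((∑ n ∈ K, ‖a n‖ ^ 2 : ℝ) : ℂ) := by
    rw [← integral_complex_ofReal]
    push_cast
    exact h1
  exact_mod_cast h2

/-- The `L⁴` bound for trigonometric polynomials in terms of a weighted `ℓ²` norm. -/
lemma integral_norm_sum_mFourier_pow_four_le (F : Finset (Fin d → ℤ)) (c : (Fin d → ℤ) → ℂ)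
    (w : (Fin d → ℤ) → ℝ) (hw : ∀ n, 0 < w n) {W : ℝ} (hW : ∑ n ∈ F, (w n ^ 2)⁻¹ ≤ W) :
    ∫ t, ‖(∑ n ∈ F, c n • mFourier n : C(UnitAddTorus (Fin d), ℂ)) t‖ ^ 4
      ≤ W * (∑ n ∈ F, w n * ‖c n‖ ^ 2) ^ 2 := by
  classical
  set K := (F ×ˢ F).image fun p => p.1 + p.2
  have hK : ∀ p ∈ F ×ˢ F, p.1 + p.2 ∈ K := fun p hp => Finset.mem_image_of_mem _ hp
  refine le_trans (le_of_eq ?_) (sum_norm_convolution_sq_le F K hK c w hw hW)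
  rw [← integral_norm_sum_mFourier_sq]
  refine integral_congr_ae (Eventually.of_forall fun t => ?_)
  -- Squaring turns the `L⁴` norm into an `L²` norm, which Parseval evaluates through the
  -- self-convolution of the coefficients.
  have hsq : (∑ n ∈ F, c n • mFourier n : C(UnitAddTorus (Fin d), ℂ)) t ^ 2
      = (∑ k ∈ K, (∑ p ∈ F ×ˢ F with p.1 + p.2 = k, c p.1 * c p.2) • mFourier k :
        C(UnitAddTorus (Fin d), ℂ)) t := by
    simp only [ContinuousMap.sum_apply, ContinuousMap.smul_apply, smul_eq_mul, Finset.sum_mul]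
    rw [pow_two, Finset.sum_mul_sum, ← Finset.sum_product', ← Finset.sum_fiberwise_of_maps_to hK]
    refine Finset.sum_congr rfl fun k _ => Finset.sum_congr rfl fun p hp => ?_
    rw [← (Finset.mem_filter.1 hp).2, mFourier_add]
    ring
  simp only
  rw [← hsq, norm_pow]
  ring

/-- The Sobolev embedding `H¹ ⊂ L⁴` on the torus of dimension at most three. -/
lemma memLp_four_of_summable (hd : d < 4)
    (f : Lp ℂ 2 (volume : Measure (UnitAddTorus (Fin d))))
    (hf : Summable fun n => (1 + ∑ i, (n i : ℝ) ^ 2) * ‖mFourierCoeff f n‖ ^ 2) :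
    MemLp f 4 (volume : Measure (UnitAddTorus (Fin d))) := by
  set w : (Fin d → ℤ) → ℝ := fun n => 1 + ∑ i, (n i : ℝ) ^ 2
  have hw : ∀ n, 0 < w n := fun n => by positivity
  have hWs : Summable fun n => (w n ^ 2)⁻¹ := summable_inv_one_add_sq_sq hd
  set W := ∑' n, (w n ^ 2)⁻¹
  set A := ∑' n, w n * ‖mFourierCoeff f n‖ ^ 2
  set S : Finset (Fin d → ℤ) → C(UnitAddTorus (Fin d), ℂ) :=
    fun F => ∑ n ∈ F, mFourierCoeff f n • mFourier n
  have hbound : ∀ F, eLpNorm (S F) 4 volume ≤ ENNReal.ofReal ((W * A ^ 2) ^ (1 / 4 : ℝ)) := by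
    intro F
    have hmem : MemLp (S F) 4 volume :=
      (S F).continuous.memLp_of_hasCompactSupport (HasCompactSupport.of_compactSpace _)
    rw [hmem.eLpNorm_eq_integral_rpow_norm (by norm_num) (by norm_num)]
    have h4 : ((4 : ℝ≥0∞)).toReal = (4 : ℕ) := by norm_num
    simp only [h4, Real.rpow_natCast]
    refine ENNReal.ofReal_le_ofReal ?_
    rw [← one_div, Nat.cast_ofNat]
    refine Real.rpow_le_rpow (integral_nonneg fun t => by positivity) ?_ (by norm_num)
    refine (integral_norm_sum_mFourier_pow_four_le F _ w hw
      (hWs.sum_le_tsum F fun n _ => by positivity)).trans ?_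
    have hA : ∑ n ∈ F, w n * ‖mFourierCoeff f n‖ ^ 2 ≤ A :=
      hf.sum_le_tsum F fun n _ => mul_nonneg (hw n).le (by positivity)
    have h0 : 0 ≤ ∑ n ∈ F, w n * ‖mFourierCoeff f n‖ ^ 2 :=
      Finset.sum_nonneg fun n _ => mul_nonneg (hw n).le (by positivity)
    have : 0 ≤ W := tsum_nonneg fun n => by positivity
    gcongr
  obtain ⟨Fs, hFs⟩ := Filter.exists_seq_tendsto (atTop : Filter (Finset (Fin d → ℤ)))
  -- The partial sums converge in `L²`, so a subsequence converges almost everywhere; Fatou then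
  -- transfers the uniform `L⁴` bound to `f`.
  have hlim : Tendsto (fun j => ContinuousMap.toLp (E := ℂ) 2 volume ℂ (S (Fs j))) atTop (𝓝 f) := by
    have := (hasSum_mFourier_series_L2 f).comp hFs
    refine this.congr fun j => ?_
    simp [S, mFourierLp, map_sum]
  obtain ⟨ns, -, hns⟩ := (tendstoInMeasure_of_tendsto_Lp hlim).exists_seq_tendsto_ae
  refine ⟨Lp.aestronglyMeasurable f, lt_of_le_of_lt
    (Lp.eLpNorm_lim_le_liminf_eLpNorm (fun j => Lp.aestronglyMeasurable _) f hns) ?_⟩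
  refine lt_of_le_of_lt (liminf_le_of_frequently_le' (Frequently.of_forall fun j => ?_))
    (ENNReal.ofReal_lt_top (r := (W * A ^ 2) ^ (1 / 4 : ℝ)))
  rw [eLpNorm_congr_ae (ContinuousMap.coeFn_toLp volume _)]
  exact hbound _

end Torus

/-! ### Fourier analysis on the cell: Sobolev embedding and Poincaré inequality -/

section Transfer

open UnitAddTorus

attribute [local instance] instMeasureSpaceUnitAddCircle isProbabilityMeasure_unitAddCircle

variable {d : ℕ} {ℓ : ℝ}

/-- The rescaled quotient map from `ℝᵈ` to the unit torus. -/
def toTorus (ℓ : ℝ) (x : Fin d → ℝ) : UnitAddTorus (Fin d) :=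
  fun i => ((ℓ⁻¹ * x i : ℝ) : UnitAddCircle)

/-- The section of `toTorus` with values in the half-open cell. -/
def fromTorus (ℓ : ℝ) (t : UnitAddTorus (Fin d)) : Fin d → ℝ :=
  fun i => ℓ * (AddCircle.equivIoc 1 0 (t i) : ℝ)

lemma measurable_fromTorus : Measurable (fromTorus (d := d) ℓ) := by
  refine measurable_pi_lambda _ fun i => Measurable.const_mul ?_ ℓ
  exact measurable_subtype_coe.comp
    ((AddCircle.measurableEquivIoc 1 0).measurable.comp (measurable_pi_apply i))

lemma fromTorus_toTorus (hℓ : 0 < ℓ) {x : Fin d → ℝ} (hx : x ∈ cell d ℓ) :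
    fromTorus ℓ (toTorus ℓ x) = x := by
  ext i
  have hi := hx i trivial
  have h : ℓ⁻¹ * x i ∈ Set.Ioc (0 : ℝ) (0 + 1) := by
    refine ⟨mul_pos (inv_pos.2 hℓ) hi.1, ?_⟩
    rw [inv_mul_le_iff₀ hℓ]
    linarith [hi.2]
  simp only [fromTorus, toTorus]
  rw [AddCircle.equivIoc_coe_of_mem h]
  field_simp

lemma measurePreserving_toCircle (hℓ : 0 < ℓ) :
    MeasurePreserving (fun x : ℝ => ((ℓ⁻¹ * x : ℝ) : UnitAddCircle))
      (volume.restrict (Set.Ioo 0 ℓ)) (ENNReal.ofReal ℓ • volume) := by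
  have h1 : MeasurePreserving (fun x : ℝ => ℓ⁻¹ * x) volume (ENNReal.ofReal ℓ • volume) := by
    refine ⟨measurable_const_mul _, ?_⟩
    rw [Real.map_volume_mul_left (inv_ne_zero hℓ.ne'), inv_inv, abs_of_pos hℓ]
  have h2 := h1.restrict_preimage (measurableSet_Ioo (a := (0 : ℝ)) (b := 1))
  have hpre : (fun x : ℝ => ℓ⁻¹ * x) ⁻¹' Set.Ioo 0 1 = Set.Ioo 0 ℓ := by
    ext x
    simp only [Set.mem_preimage, Set.mem_Ioo]
    rw [inv_mul_lt_iff₀ hℓ, mul_one, mul_pos_iff_of_pos_left (inv_pos.2 hℓ)]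
  rw [hpre, Measure.restrict_smul, 
    Measure.restrict_congr_set (Ioo_ae_eq_Ioc (a := (0 : ℝ)) (b := 1))] at h2
  have h3 : MeasurePreserving ((↑) : ℝ → UnitAddCircle) (volume.restrict (Set.Ioc 0 1)) volume := by
    have h := AddCircle.measurePreserving_mk 1 0
    rw [AddCircle.volume_eq_smul_haarAddCircle, ENNReal.ofReal_one, one_smul, zero_add] at h
    exact h
  exact (h3.smul_measure (ENNReal.ofReal ℓ)).comp h2

lemma measurePreserving_toTorus (hℓ : 0 < ℓ) :
    MeasurePreserving (toTorus (d := d) ℓ) (cellMeasure d ℓ)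
      (ENNReal.ofReal ℓ ^ d • (volume : Measure (UnitAddTorus (Fin d)))) := by
  have : IsFiniteMeasure (ENNReal.ofReal ℓ • (volume : Measure UnitAddCircle)) :=
    Measure.smul_finite _ ENNReal.ofReal_ne_top
  have h := measurePreserving_pi (fun _ : Fin d => volume.restrict (Set.Ioo 0 ℓ))
    (fun _ : Fin d => ENNReal.ofReal ℓ • (volume : Measure UnitAddCircle))
    (fun _ => measurePreserving_toCircle hℓ)
  rw [← Measure.restrict_pi_pi, ← volume_pi] at h
  have hpi : Measure.pi (fun _ : Fin d => ENNReal.ofReal ℓ • (volume : Measure UnitAddCircle))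
      = ENNReal.ofReal ℓ ^ d • (volume : Measure (UnitAddTorus (Fin d))) := by
    refine Measure.pi_eq fun s _ => ?_
    rw [Measure.smul_apply, volume_pi, Measure.pi_pi]
    simp [Finset.prod_mul_distrib]
  rw [hpi] at h
  exact h

/-- Composition with `fromTorus` is legitimate on classes because `toTorus` carries the cell measure
to `ℓᵈ` times the torus measure and `fromTorus` inverts it on the open cell. -/
lemma exists_torus_representative (hℓ : 0 < ℓ) (v : L2 d ℓ) :
    ∃ f : Lp ℂ 2 (volume : Measure (UnitAddTorus (Fin d))),
      ∀ᵐ x ∂(cellMeasure d ℓ), f (toTorus ℓ x) = (v x : ℂ) := by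
  have hmp := measurePreserving_toTorus (d := d) hℓ
  have hc : ENNReal.ofReal ℓ ^ d ≠ 0 := by simpa using fun h => absurd h hℓ.not_ge
  have hc' : ENNReal.ofReal ℓ ^ d ≠ ⊤ := by simp
  set g : UnitAddTorus (Fin d) → ℂ := fun t => (v (fromTorus ℓ t) : ℂ) with hg
  have hsm : StronglyMeasurable g :=
    Complex.continuous_ofReal.comp_stronglyMeasurable
      ((Lp.stronglyMeasurable v).comp_measurable measurable_fromTorus)
  have hgv : ∀ᵐ x ∂(cellMeasure d ℓ), g (toTorus ℓ x) = (v x : ℂ) := by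
    filter_upwards [ae_restrict_mem (measurableSet_cell d ℓ)] with x hx
    rw [hg]
    simp only [fromTorus_toTorus hℓ hx]
  have hmem : MemLp g 2 (ENNReal.ofReal ℓ ^ d • (volume : Measure (UnitAddTorus (Fin d)))) := by
    rw [← hmp.map_eq, memLp_map_measure_iff hsm.aestronglyMeasurable hmp.aemeasurable]
    exact (memLp_congr_ae hgv).2 (Lp.memLp v).ofReal
  have hmem' : MemLp g 2 (volume : Measure (UnitAddTorus (Fin d))) := by
    have := hmem.smul_measure (ENNReal.inv_ne_top.2 hc)
    rwa [smul_smul, ENNReal.inv_mul_cancel hc hc', one_smul] at this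
  refine ⟨hmem'.toLp g, ?_⟩
  have hae : ∀ᵐ t ∂(ENNReal.ofReal ℓ ^ d • (volume : Measure (UnitAddTorus (Fin d)))),
      hmem'.toLp g t = g t := Measure.ae_smul_measure hmem'.coeFn_toLp _
  filter_upwards [hmp.quasiMeasurePreserving.ae hae, hgv] with x h1 h2
  rw [h1, h2]

lemma integral_comp_toTorus (hℓ : 0 < ℓ) {E : Type*} [NormedAddCommGroup E] [NormedSpace ℝ E]
    {h : UnitAddTorus (Fin d) → E} (hh : AEStronglyMeasurable h volume) :
    ∫ x, h (toTorus ℓ x) ∂(cellMeasure d ℓ) = ℓ ^ d • ∫ t, h t := by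
  have hmp := measurePreserving_toTorus (d := d) hℓ
  rw [← integral_map hmp.aemeasurable (by rw [hmp.map_eq]; exact hh.smul_measure _), hmp.map_eq,
    integral_smul_measure, ENNReal.toReal_pow, ENNReal.toReal_ofReal hℓ.le]

/-- The phase `2π n·x/ℓ`. -/
def phase (ℓ : ℝ) (n : Fin d → ℤ) (x : Fin d → ℝ) : ℝ := ∑ i, 2 * Real.pi * n i / ℓ * x i

lemma mFourier_neg_toTorus (n : Fin d → ℤ) (x : Fin d → ℝ) :
    mFourier (-n) (toTorus ℓ x) =
      (Real.cos (phase ℓ n x) : ℂ) - Complex.I * (Real.sin (phase ℓ n x) : ℂ) := by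
  have h : mFourier (-n) (toTorus ℓ x) = Complex.exp ((-phase ℓ n x : ℝ) * Complex.I) := by
    simp only [mFourier, ContinuousMap.coe_mk, toTorus, fourier_coe_apply, phase]
    rw [← Complex.exp_sum]
    congr 1
    push_cast
    rw [← Finset.sum_neg_distrib, Finset.sum_mul]
    refine Finset.sum_congr rfl fun i _ => ?_
    simp
    ring
  rw [h, Complex.exp_mul_I, ← Complex.ofReal_cos, ← Complex.ofReal_sin, Real.cos_neg, Real.sin_neg]
  push_cast
  ring

lemma contDiff_phase (n : Fin d → ℤ) : ContDiff ℝ ∞ (phase ℓ n) := by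
  unfold phase
  fun_prop

lemma phase_add_single (hℓ : 0 < ℓ) (n : Fin d → ℤ) (x : Fin d → ℝ) (j : Fin d) :
    phase ℓ n (x + Pi.single j ℓ) = phase ℓ n x + n j * (2 * Real.pi) := by
  simp only [phase, Pi.add_apply, mul_add, Finset.sum_add_distrib, Pi.single_apply]
  simp
  field_simp

lemma hasFDerivAt_phase (n : Fin d → ℤ) (x : Fin d → ℝ) :
    HasFDerivAt (phase ℓ n)
      (∑ i, (2 * Real.pi * n i / ℓ) • (ContinuousLinearMap.proj i : (Fin d → ℝ) →L[ℝ] ℝ)) x := by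
  unfold phase
  exact HasFDerivAt.fun_sum fun i _ => (hasFDerivAt_apply i x).const_mul _

lemma isPeriodicTest_cos (hℓ : 0 < ℓ) (n : Fin d → ℤ) :
    IsPeriodicTest ℓ fun x : Fin d → ℝ => Real.cos (phase ℓ n x) :=
  ⟨Real.contDiff_cos.comp (contDiff_phase n), fun j x => by
    simp only [phase_add_single hℓ, Real.cos_add_int_mul_two_pi]⟩

lemma isPeriodicTest_sin (hℓ : 0 < ℓ) (n : Fin d → ℤ) :
    IsPeriodicTest ℓ fun x : Fin d → ℝ => Real.sin (phase ℓ n x) :=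
  ⟨Real.contDiff_sin.comp (contDiff_phase n), fun j x => by
    simp only [phase_add_single hℓ, Real.sin_add_int_mul_two_pi]⟩

lemma fderiv_cos_phase (n : Fin d → ℤ) (x : Fin d → ℝ) (i : Fin d) :
    fderiv ℝ (fun x => Real.cos (phase ℓ n x)) x (Pi.single i 1)
      = -(2 * Real.pi * n i / ℓ) * Real.sin (phase ℓ n x) := by
  rw [(hasFDerivAt_phase n x).cos.fderiv]
  simp [Pi.single_apply]
  ring

lemma fderiv_sin_phase (n : Fin d → ℤ) (x : Fin d → ℝ) (i : Fin d) :
    fderiv ℝ (fun x => Real.sin (phase ℓ n x)) x (Pi.single i 1)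
      = 2 * Real.pi * n i / ℓ * Real.cos (phase ℓ n x) := by
  rw [(hasFDerivAt_phase n x).sin.fderiv]
  simp [Pi.single_apply]
  ring

/-- The Fourier coefficients of a torus representative, as integrals over the cell. -/
lemma mFourierCoeff_representative (hℓ : 0 < ℓ) {v : L2 d ℓ}
    {f : Lp ℂ 2 (volume : Measure (UnitAddTorus (Fin d)))}
    (hf : ∀ᵐ x ∂(cellMeasure d ℓ), f (toTorus ℓ x) = (v x : ℂ)) (n : Fin d → ℤ) :
    (ℓ : ℂ) ^ d * mFourierCoeff f n
      = ((∫ x, v x * Real.cos (phase ℓ n x) ∂(cellMeasure d ℓ) : ℝ) : ℂ)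
        - Complex.I * ((∫ x, v x * Real.sin (phase ℓ n x) ∂(cellMeasure d ℓ) : ℝ) : ℂ) := by
  have h1 := integral_comp_toTorus hℓ (h := fun t => mFourier (-n) t • f t)
    ((mFourier (-n)).continuous.aestronglyMeasurable.smul (Lp.aestronglyMeasurable f))
  have h2 : (ℓ : ℂ) ^ d * mFourierCoeff f n
      = ℓ ^ d • ∫ t, mFourier (-n) t • f t := by
    rw [mFourierCoeff, Complex.real_smul]
    push_cast
    rfl
  have hcos := integrable_mul_of_continuous v 
    (Real.continuous_cos.comp (contDiff_phase (ℓ := ℓ) n).continuous)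
  have hsin := integrable_mul_of_continuous v 
    (Real.continuous_sin.comp (contDiff_phase (ℓ := ℓ) n).continuous)
  rw [h2, ← h1, ← integral_complex_ofReal, ← integral_complex_ofReal, ← integral_const_mul,
    ← integral_sub hcos.ofReal (hsin.ofReal.const_mul _)]
  refine integral_congr_ae ?_
  filter_upwards [hf] with x hx
  rw [hx, mFourier_neg_toTorus, smul_eq_mul]
  push_cast
  ring

/-- The cosine and sine of the phase are admissible real test functions. Testing with both shows
that `∂ᵢ` multiplies the coefficient by `2πi nᵢ / ℓ`. -/
lemma mFourierCoeff_weakPartial (hℓ : 0 < ℓ) {v g : L2 d ℓ} {i : Fin d} (hvg : IsWeakPartial i v g)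
    {f h : Lp ℂ 2 (volume : Measure (UnitAddTorus (Fin d)))}
    (hf : ∀ᵐ x ∂(cellMeasure d ℓ), f (toTorus ℓ x) = (v x : ℂ))
    (hh : ∀ᵐ x ∂(cellMeasure d ℓ), h (toTorus ℓ x) = (g x : ℂ)) (n : Fin d → ℤ) :
    ‖mFourierCoeff h n‖ ^ 2 = (2 * Real.pi / ℓ) ^ 2 * ((n i : ℝ) ^ 2 * ‖mFourierCoeff f n‖ ^ 2) := by
  have hc := hvg _ (isPeriodicTest_cos hℓ n)
  have hs := hvg _ (isPeriodicTest_sin hℓ n)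
  simp only [fderiv_cos_phase, fderiv_sin_phase, mul_left_comm _ (2 * Real.pi * n i / ℓ),
    mul_left_comm _ (-(2 * Real.pi * n i / ℓ)), integral_const_mul] at hc hs
  have e1 := mFourierCoeff_representative hℓ hf n
  have e2 := mFourierCoeff_representative hℓ hh n
  have hℓ' : (ℓ : ℂ) ^ d ≠ 0 := pow_ne_zero _ (by exact_mod_cast hℓ.ne')
  have key : mFourierCoeff h n
      = ((2 * Real.pi * n i / ℓ : ℝ) : ℂ) * Complex.I * mFourierCoeff f n := by
    refine mul_left_cancel₀ hℓ' ?_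
    rw [mul_left_comm, e1, e2]
    rw [neg_eq_iff_eq_neg.1 hs.symm, ← neg_eq_iff_eq_neg.2 hc]
    push_cast
    linear_combination ((2 * Real.pi * n i / ℓ : ℂ) *
      ((∫ x, v x * Real.sin (phase ℓ n x) ∂(cellMeasure d ℓ) : ℝ) : ℂ)) * Complex.I_sq
  rw [key, norm_mul, norm_mul, Complex.norm_I, Complex.norm_real, mul_one, mul_pow, Real.norm_eq_abs,
    sq_abs]
  ring

lemma hasSum_sq_mFourierCoeff_representative (hℓ : 0 < ℓ) {v : L2 d ℓ}
    {f : Lp ℂ 2 (volume : Measure (UnitAddTorus (Fin d)))}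
    (hf : ∀ᵐ x ∂(cellMeasure d ℓ), f (toTorus ℓ x) = (v x : ℂ)) :
    HasSum (fun n => ℓ ^ d * ‖mFourierCoeff f n‖ ^ 2) (‖v‖ ^ 2) := by
  have h := (hasSum_sq_mFourierCoeff f).mul_left (ℓ ^ d)
  have h1 := integral_comp_toTorus hℓ (h := fun t => ‖f t‖ ^ 2)
    ((Lp.aestronglyMeasurable f).norm.pow 2)
  rw [smul_eq_mul] at h1
  rw [← h1] at h
  suffices hv : ‖v‖ ^ 2 = ∫ x, ‖f (toTorus ℓ x)‖ ^ 2 ∂(cellMeasure d ℓ) by rw [hv]; exact h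
  rw [← real_inner_self_eq_norm_sq, L2.inner_def]
  refine integral_congr_ae ?_
  filter_upwards [hf] with x hx
  rw [hx]
  simp [pow_two]

lemma hasSum_sq_gradient (hℓ : 0 < ℓ) {v : L2 d ℓ} {g : Fin d → L2 d ℓ}
    (hvg : ∀ i, IsWeakPartial i v (g i)) {f : Lp ℂ 2 (volume : Measure (UnitAddTorus (Fin d)))}
    (hf : ∀ᵐ x ∂(cellMeasure d ℓ), f (toTorus ℓ x) = (v x : ℂ)) :
    HasSum (fun n => ℓ ^ d * ((2 * Real.pi / ℓ) ^ 2 *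
      ((∑ i, (n i : ℝ) ^ 2) * ‖mFourierCoeff f n‖ ^ 2))) (∑ i, ‖g i‖ ^ 2) := by
  have h : ∀ i, HasSum (fun n => ℓ ^ d * ((2 * Real.pi / ℓ) ^ 2 *
      ((n i : ℝ) ^ 2 * ‖mFourierCoeff f n‖ ^ 2))) (‖g i‖ ^ 2) := by
    intro i
    obtain ⟨h, hh⟩ := exists_torus_representative hℓ (g i)
    convert hasSum_sq_mFourierCoeff_representative hℓ hh using 2 with n
    rw [mFourierCoeff_weakPartial hℓ (hvg i) hf hh]
  convert hasSum_sum (s := Finset.univ) fun i _ => h i using 2 with n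
  rw [Finset.sum_mul, Finset.mul_sum, Finset.mul_sum]

/-- The Sobolev embedding of periodic `H¹` into `L⁴` in dimension at most three. -/
lemma memLp_four_of_isWeakPartial (hd : d < 4) (hℓ : 0 < ℓ) {v : L2 d ℓ} {g : Fin d → L2 d ℓ}
    (hvg : ∀ i, IsWeakPartial i v (g i)) : MemLp v 4 (cellMeasure d ℓ) := by
  obtain ⟨f, hf⟩ := exists_torus_representative hℓ v
  have hmp := measurePreserving_toTorus (d := d) hℓ
  have h1 := (hasSum_sq_mFourierCoeff_representative hℓ hf).summable
  have h2 := (hasSum_sq_gradient hℓ hvg hf).summable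
  have hsum : Summable fun n => (1 + ∑ i, (n i : ℝ) ^ 2) * ‖mFourierCoeff f n‖ ^ 2 := by
    refine ((h1.mul_left (ℓ ^ d)⁻¹).add
      (h2.mul_left ((ℓ ^ d)⁻¹ * ((2 * Real.pi / ℓ) ^ 2)⁻¹))).congr fun n => ?_
    have := Real.pi_pos
    field_simp
  have h4 := (memLp_four_of_summable hd f hsum).smul_measure (c := ENNReal.ofReal ℓ ^ d) (by simp)
  have h5 := h4.comp_measurePreserving hmp
  have h6 : MemLp (fun x => (v x : ℂ)) 4 (cellMeasure d ℓ) := (memLp_congr_ae hf).1 h5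
  simpa using h6.re

/-- The Poincaré inequality for mean-zero periodic functions. -/
lemma norm_sq_le_of_isWeakPartial (hℓ : 0 < ℓ) {v : L2 d ℓ} {g : Fin d → L2 d ℓ}
    (hv : ∫ x, v x ∂(cellMeasure d ℓ) = 0) (hvg : ∀ i, IsWeakPartial i v (g i)) :
    (2 * Real.pi / ℓ) ^ 2 * ‖v‖ ^ 2 ≤ ∑ i, ‖g i‖ ^ 2 := by
  obtain ⟨f, hf⟩ := exists_torus_representative hℓ v
  refine hasSum_le (fun n => ?_)
    ((hasSum_sq_mFourierCoeff_representative hℓ hf).mul_left ((2 * Real.pi / ℓ) ^ 2))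
    (hasSum_sq_gradient hℓ hvg hf)
  rw [mul_left_comm]
  gcongr
  -- The zero mode is the mean and vanishes; every other mode has `|n|² ≥ 1`.
  by_cases hn : n = 0
  · have h0 : mFourierCoeff f n = 0 := by
      have h := mFourierCoeff_representative hℓ hf n
      have hℓ' : (ℓ : ℂ) ^ d ≠ 0 := pow_ne_zero _ (by exact_mod_cast hℓ.ne')
      simpa [hn, phase, hv, hℓ'] using h
    simp [h0]
  · obtain ⟨j, hj⟩ := Function.ne_iff.1 hn
    have h1 : (1 : ℝ) ≤ (n j : ℝ) ^ 2 := by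
      have : (1 : ℤ) ≤ n j ^ 2 := (one_le_sq_iff_one_le_abs _).2 (Int.one_le_abs hj)
      exact_mod_cast this
    have h2 := Finset.single_le_sum (f := fun i => (n i : ℝ) ^ 2) (fun i _ => sq_nonneg _)
      (Finset.mem_univ j)
    exact le_mul_of_one_le_left (sq_nonneg _) (h1.trans h2)

end Transfer

/-! ### Completeness of `H1`, coercivity and symmetry of the operators -/

section Operators

variable {d : ℕ} {ℓ : ℝ}

/-- The integral is the `L²` pairing with a fixed function. This makes the conditions defining `H1`
closed, hence `H1` complete. -/
lemma continuous_integral_mul {ψ : (Fin d → ℝ) → ℝ} (hψ : Continuous ψ) :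
    Continuous fun v : L2 d ℓ => ∫ x, v x * ψ x ∂(cellMeasure d ℓ) := by
  obtain ⟨C, hC⟩ := (isCompact_univ_pi (fun _ : Fin d => isCompact_Icc (a := (0 : ℝ)) (b := ℓ))
    ).exists_bound_of_continuousOn hψ.continuousOn
  have hmem : MemLp ψ 2 (cellMeasure d ℓ) := by
    refine MemLp.of_bound hψ.aestronglyMeasurable C ?_
    filter_upwards [ae_restrict_mem (measurableSet_cell d ℓ)] with x hx
    exact hC x (cell_subset d ℓ hx)
  have h : (fun v : L2 d ℓ => ∫ x, v x * ψ x ∂(cellMeasure d ℓ))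
      = fun v => inner ℝ (hmem.toLp ψ) v := by
    ext v
    rw [L2.inner_def]
    refine integral_congr_ae ?_
    filter_upwards [hmem.coeFn_toLp] with x hx
    simp [hx]
  rw [h]
  fun_prop

lemma isClosed_H1 : IsClosed (H1 d ℓ : Set (WithLp 2 (L2 d ℓ × PiLp 2 fun _ : Fin d => L2 d ℓ))) := by
  have hfst : Continuous fun p : WithLp 2 (L2 d ℓ × PiLp 2 fun _ : Fin d => L2 d ℓ) => p.fst :=
    (WithLp.fstL 2 ℝ (L2 d ℓ) (PiLp 2 fun _ : Fin d => L2 d ℓ)).continuous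
  have hsnd (i : Fin d) :
      Continuous fun p : WithLp 2 (L2 d ℓ × PiLp 2 fun _ : Fin d => L2 d ℓ) => p.snd i :=
    (PiLp.proj 2 (fun _ : Fin d => L2 d ℓ) i ∘L
      WithLp.sndL 2 ℝ (L2 d ℓ) (PiLp 2 fun _ : Fin d => L2 d ℓ)).continuous
  refine IsClosed.and (isClosed_eq ?_ continuous_const) ?_
  · simpa [Function.comp_def] using
      (continuous_integral_mul (d := d) (ℓ := ℓ) (continuous_const (y := 1))).comp hfst
  · simp only [IsWeakPartial, Set.ofPred_forall]
    exact isClosed_iInter fun i => isClosed_iInter fun φ => isClosed_iInter fun hφ => isClosed_eq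
      ((continuous_integral_mul (hφ.continuous_fderiv _)).comp hfst)
      ((continuous_integral_mul hφ.1.continuous).comp (hsnd i)).neg

instance completeSpace_H1 : CompleteSpace (H1 d ℓ) := isClosed_H1.completeSpace_coe

lemma isWeakPartial_partialDeriv (v : H1 d ℓ) (i : Fin d) :
    IsWeakPartial i (toL2 v) (partialDeriv i v) := v.2.2 i

lemma norm_sq_H1 (v : H1 d ℓ) : ‖v‖ ^ 2 = ‖toL2 v‖ ^ 2 + ∑ i, ‖partialDeriv i v‖ ^ 2 := by
  have h1 := WithLp.prod_norm_sq_eq_of_L2 v.1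
  rw [PiLp.norm_sq_eq_of_L2] at h1
  exact h1

lemma poincare (hℓ : 0 < ℓ) (v : H1 d ℓ) :
    (2 * Real.pi / ℓ) ^ 2 * ‖toL2 v‖ ^ 2 ≤ ∑ i, ‖partialDeriv i v‖ ^ 2 :=
  norm_sq_le_of_isWeakPartial hℓ v.2.1 (isWeakPartial_partialDeriv v)

lemma exists_gradient_coercive (d : ℕ) (hℓ : 0 < ℓ) :
    ∃ c > 0, ∀ v : H1 d ℓ, c * ‖v‖ ^ 2 ≤ ∑ i, ‖partialDeriv i v‖ ^ 2 := by
  have hp : 0 < (2 * Real.pi / ℓ) ^ 2 := by have := Real.pi_pos; positivity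
  refine ⟨(1 + ((2 * Real.pi / ℓ) ^ 2)⁻¹)⁻¹, by positivity, fun v => ?_⟩
  rw [inv_mul_le_iff₀ (by positivity), norm_sq_H1, add_mul, one_mul, add_comm]
  gcongr
  rw [le_inv_mul_iff₀ hp]
  exact poincare hℓ v

lemma negLap_apply (v w : H1 d ℓ) :
    negLap v w = ∑ i, inner ℝ (partialDeriv i v) (partialDeriv i w) := by
  simp [negLap]

lemma negLap_self (v : H1 d ℓ) : negLap v v = ∑ i, ‖partialDeriv i v‖ ^ 2 := by
  simp [negLap_apply]

lemma negLap_symm (v w : H1 d ℓ) : negLap v w = negLap w v := by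
  simp only [negLap_apply, real_inner_comm]

lemma gelfand_apply (v w : H1 d ℓ) : gelfand v w = inner ℝ (toL2 v) (toL2 w) := rfl

lemma gelfand_symm (v w : H1 d ℓ) : gelfand v w = gelfand w v := by
  simp only [gelfand_apply, real_inner_comm]

lemma negLapM_apply (M : Linf d ℓ) (v w : H1 d ℓ) :
    negLapM M v w = ∑ i, inner ℝ (mulBy M (partialDeriv i v)) (partialDeriv i w) := by
  simp [negLapM]

lemma coeFn_mulBy (M : Linf d ℓ) (g : L2 d ℓ) :
    ∀ᵐ x ∂(cellMeasure d ℓ), mulBy M g x = M x * g x :=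
  ContinuousLinearMap.coeFn_holder (r := 2) (ContinuousLinearMap.mul ℝ ℝ) M g

lemma inner_mulBy_symm (M : Linf d ℓ) (g h : L2 d ℓ) :
    inner ℝ (mulBy M g) h = inner ℝ (mulBy M h) g := by
  rw [L2.inner_def, L2.inner_def]
  refine integral_congr_ae ?_
  filter_upwards [coeFn_mulBy M g, coeFn_mulBy M h] with x h1 h2
  rw [h1, h2]
  simp
  ring

lemma le_inner_mulBy {M : Linf d ℓ} {m : ℝ} (hM : ∀ᵐ x ∂(cellMeasure d ℓ), m ≤ M x) (g : L2 d ℓ) :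
    m * ‖g‖ ^ 2 ≤ inner ℝ (mulBy M g) g := by
  rw [← real_inner_self_eq_norm_sq, L2.inner_def, L2.inner_def, ← integral_const_mul]
  refine integral_mono_ae ((L2.integrable_inner g g).const_mul m)
    (L2.integrable_inner (mulBy M g) g) ?_
  filter_upwards [coeFn_mulBy M g, hM] with x h1 h2
  simp only [h1, Real.inner_apply]
  nlinarith [mul_self_nonneg (g x)]

lemma negLapM_symm (M : Linf d ℓ) (v w : H1 d ℓ) : negLapM M v w = negLapM M w v := by
  simp only [negLapM_apply]
  exact Finset.sum_congr rfl fun i _ => inner_mulBy_symm M _ _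

lemma le_negLapM_self {M : Linf d ℓ} {m : ℝ} (hM : ∀ᵐ x ∂(cellMeasure d ℓ), m ≤ M x)
    (v : H1 d ℓ) : m * ∑ i, ‖partialDeriv i v‖ ^ 2 ≤ negLapM M v v := by
  rw [negLapM_apply, Finset.mul_sum]
  exact Finset.sum_le_sum fun i _ => le_inner_mulBy hM _

/-- The bilinear form `⟨A⁻¹ v, w⟩` for an invertible symmetric `A`. -/
lemma gelfand_inverse_symm {A : H1 d ℓ →L[ℝ] Hneg d ℓ} (hinv : A.IsInvertible)
    (hA : ∀ v w, A v w = A w v) (v w : H1 d ℓ) :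
    gelfand (A.inverse (gelfand v)) w = gelfand (A.inverse (gelfand w)) v := by
  rw [gelfand_symm, ← hinv.self_apply_inverse (gelfand w), hA,
    hinv.self_apply_inverse (gelfand v), hinv.self_apply_inverse (gelfand w), gelfand_symm]

/-- With `x = A⁻¹ v` the pairing is `⟨A x, x⟩`. -/
lemma gelfand_inverse_self_nonneg {A : H1 d ℓ →L[ℝ] Hneg d ℓ} (hinv : A.IsInvertible)
    (hA : ∀ v, 0 ≤ A v v) (v : H1 d ℓ) : 0 ≤ gelfand (A.inverse (gelfand v)) v := by
  have h := hA (A.inverse (gelfand v))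
  rwa [hinv.self_apply_inverse, gelfand_symm] at h

lemma precond_apply (lam γ : ℝ) (v w : H1 d ℓ) :
    precond lam γ v w = lam * gelfand (negLap.inverse (gelfand v)) w + γ * gelfand v w
      + negLap v w := by
  simp [precond]

lemma precond_symm (hinv : (negLap : H1 d ℓ →L[ℝ] Hneg d ℓ).IsInvertible) (lam γ : ℝ)
    (v w : H1 d ℓ) : precond lam γ v w = precond lam γ w v := by
  rw [precond_apply, precond_apply, gelfand_inverse_symm hinv negLap_symm, gelfand_symm v w,
    negLap_symm v w]

/-- The zeroth-order terms of `ℒ` are nonnegative, so `ℒ` inherits the coercivity constant of `-Δ`.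
-/
lemma negLap_le_precond (hinv : (negLap : H1 d ℓ →L[ℝ] Hneg d ℓ).IsInvertible) {lam γ : ℝ}
    (hlam : 0 ≤ lam) (hγ : 0 ≤ γ) (v : H1 d ℓ) : negLap v v ≤ precond lam γ v v := by
  have h1 := gelfand_inverse_self_nonneg hinv (fun v => by rw [negLap_self]; positivity) v
  have h2 : 0 ≤ gelfand v v := by rw [gelfand_apply]; exact real_inner_self_nonneg
  rw [precond_apply]
  nlinarith [mul_nonneg hlam h1, mul_nonneg hγ h2]

end Operators

/-! ### The embedding into `L⁴` and the quartic term -/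

section Energy

variable {d : ℕ} {ℓ : ℝ}

instance holderTriple_four_four_two : ENNReal.HolderTriple 4 4 2 :=
  ⟨by
    rw [← two_mul, show (4 : ℝ≥0∞) = 2 * 2 by norm_num,
      ENNReal.mul_inv (by simp) (by simp), ← mul_assoc,
      ENNReal.mul_inv_cancel (by simp) (by simp), one_mul]⟩

instance fact_one_le_four : Fact ((1 : ℝ≥0∞) ≤ 4) := ⟨by norm_num⟩

lemma memLp_four_toL2 (hd : d < 4) (hℓ : 0 < ℓ) (v : H1 d ℓ) :
    MemLp (toL2 v) 4 (cellMeasure d ℓ) :=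
  memLp_four_of_isWeakPartial hd hℓ (isWeakPartial_partialDeriv v)

/-- The Sobolev embedding of mean-zero periodic `H¹` into `L⁴`; continuity is the closed graph
theorem. -/
lemma exists_toL4 (hd : d < 4) (hℓ : 0 < ℓ) :
    ∃ J : H1 d ℓ →L[ℝ] Lp ℝ 4 (cellMeasure d ℓ),
      ∀ v, ∀ᵐ x ∂(cellMeasure d ℓ), J v x = toL2 v x := by
  let g : H1 d ℓ →ₗ[ℝ] Lp ℝ 4 (cellMeasure d ℓ) :=
    { toFun := fun v => (memLp_four_toL2 hd hℓ v).toLp _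
      map_add' := fun v w => by
        rw [← MemLp.toLp_add]
        exact MemLp.toLp_congr _ _ (by rw [map_add]; exact Lp.coeFn_add _ _)
      map_smul' := fun c v => by
        rw [RingHom.id_apply, ← MemLp.toLp_const_smul]
        exact MemLp.toLp_congr _ _ (by rw [map_smul]; exact Lp.coeFn_smul _ _) }
  have hg : ∀ v, ∀ᵐ x ∂(cellMeasure d ℓ), g v x = toL2 v x :=
    fun v => (memLp_four_toL2 hd hℓ v).coeFn_toLp
  -- The graph is closed because the `L⁴` limit and the `L²` limit are both limits in measure of the
  -- same sequence.
  refine ⟨ContinuousLinearMap.ofSeqClosedGraph (g := g) fun u x y hu hgu => ?_, hg⟩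
  have h1 : TendstoInMeasure (cellMeasure d ℓ) (fun n => toL2 (u n)) atTop y :=
    (tendstoInMeasure_of_tendsto_Lp hgu).congr_left fun n => hg (u n)
  have h2 : TendstoInMeasure (cellMeasure d ℓ) (fun n => toL2 (u n)) atTop (toL2 x) :=
    tendstoInMeasure_of_tendsto_Lp ((toL2.continuous.tendsto x).comp hu)
  exact Lp.ext ((tendstoInMeasure_ae_unique h1 h2).trans (EventuallyEq.symm (hg x)))

/-- Multiplication `L⁴ × L⁴ → L²`. -/
def mulL4 (d : ℕ) (ℓ : ℝ) :
    Lp ℝ 4 (cellMeasure d ℓ) →L[ℝ] Lp ℝ 4 (cellMeasure d ℓ) →L[ℝ] L2 d ℓ :=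
  (ContinuousLinearMap.mul ℝ ℝ).holderL (cellMeasure d ℓ) 4 4 2

lemma coeFn_mulL4 (a b : Lp ℝ 4 (cellMeasure d ℓ)) :
    ∀ᵐ x ∂(cellMeasure d ℓ), mulL4 d ℓ a b x = a x * b x :=
  ContinuousLinearMap.coeFn_holder (r := 2) (ContinuousLinearMap.mul ℝ ℝ) a b

lemma mulL4_symm (a b : Lp ℝ 4 (cellMeasure d ℓ)) : mulL4 d ℓ a b = mulL4 d ℓ b a := by
  refine Lp.ext ?_
  filter_upwards [coeFn_mulL4 a b, coeFn_mulL4 b a] with x h1 h2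
  rw [h1, h2, mul_comm]

/-- Both sides are `∫ a² b²`. This identity is what makes the quartic term convex in the abstract
argument. -/
lemma inner_mulL4_sq_sq (a b : Lp ℝ 4 (cellMeasure d ℓ)) :
    inner ℝ (mulL4 d ℓ a a) (mulL4 d ℓ b b) = ‖mulL4 d ℓ a b‖ ^ 2 := by
  rw [← real_inner_self_eq_norm_sq, L2.inner_def, L2.inner_def]
  refine integral_congr_ae ?_
  filter_upwards [coeFn_mulL4 a a, coeFn_mulL4 b b, coeFn_mulL4 a b] with x h1 h2 h3
  simp only [h1, h2, h3, Real.inner_apply]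
  ring

lemma norm_mulL4_self_sq (a : Lp ℝ 4 (cellMeasure d ℓ)) :
    ‖mulL4 d ℓ a a‖ ^ 2 = ∫ x, |a x| ^ 4 ∂(cellMeasure d ℓ) := by
  rw [← real_inner_self_eq_norm_sq, L2.inner_def]
  refine integral_congr_ae ?_
  filter_upwards [coeFn_mulL4 a a] with x h1
  simp only [h1, Real.inner_apply, Even.pow_abs (show Even 4 by decide)]
  ring

end Energy

/-! ### Derivative, convexity and local Lipschitz bound for quartic energies -/

section QuarticEnergy

variable {V E : Type*} [NormedAddCommGroup V] [InnerProductSpace ℝ V]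
  [NormedAddCommGroup E] [InnerProductSpace ℝ E]

/-- The sum of a shifted quadratic form, the quartic `¼‖C(v, v)‖²`, a quadratic form and a linear
form. -/
def quarticEnergy (S A : V →L[ℝ] StrongDual ℝ V) (C : V →L[ℝ] V →L[ℝ] E) (F : StrongDual ℝ V)
    (a v : V) : ℝ :=
  1 / 2 * S (v - a) (v - a) + 1 / 4 * ‖C v v‖ ^ 2 + 1 / 2 * A v v - F v

/-- The gradient of `quarticEnergy`. -/
def quarticGradient (S A : V →L[ℝ] StrongDual ℝ V) (C : V →L[ℝ] V →L[ℝ] E) (F : StrongDual ℝ V)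
    (a v : V) : StrongDual ℝ V :=
  S (v - a) + innerSL ℝ (C v v) ∘L C v + A v - F

variable {S A : V →L[ℝ] StrongDual ℝ V} {C : V →L[ℝ] V →L[ℝ] E} {F : StrongDual ℝ V}

lemma hasFDerivAt_diagonal {W : Type*} [NormedAddCommGroup W] [NormedSpace ℝ W]
    {B : V →L[ℝ] V →L[ℝ] W} (hB : ∀ v w, B v w = B w v) (v : V) :
    HasFDerivAt (fun v => B v v) ((2 : ℝ) • B v) v := by
  refine (B.hasFDerivAt_of_bilinear (hasFDerivAt_id v) (hasFDerivAt_id v)).congr_fderiv ?_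
  ext w
  simp [hB w v, two_smul]

lemma hasFDerivAt_quarticEnergy (hS : ∀ v w, S v w = S w v) (hA : ∀ v w, A v w = A w v)
    (hC : ∀ v w, C v w = C w v) (a v : V) :
    HasFDerivAt (quarticEnergy S A C F a) (quarticGradient S A C F a v) v := by
  have h1 : HasFDerivAt (fun v => S (v - a) (v - a)) ((2 : ℝ) • S (v - a)) v :=
    (HasFDerivAt.comp (g := fun v => S v v) v (hasFDerivAt_diagonal hS (v - a))
      ((hasFDerivAt_id v).sub_const a)).congr_fderiv rfl
  have h2 := (hasFDerivAt_diagonal hC v).norm_sq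
  have h3 := hasFDerivAt_diagonal hA v
  refine ((((h1.const_mul (1 / 2)).add (h2.const_mul (1 / 4))).add (h3.const_mul (1 / 2))).sub
    F.hasFDerivAt).congr_fderiv ?_
  ext w
  simp [quarticGradient]
  ring

/-- The expansion about `p` is exact. Beyond the tangent it leaves `½ S h h + ½ A h h + ½ ‖C p h‖² +
¼ ‖2 C p h + C h h‖²`, where `hC'` has turned the cross term `⟨C p p, C h h⟩` into a square; `A`
alone supplies the modulus. -/
lemma stronglyAbove_quarticEnergy (hS : ∀ v w, S v w = S w v) (hS' : ∀ v, 0 ≤ S v v)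
    (hA : ∀ v w, A v w = A w v) {m : ℝ} (hA' : ∀ v, m * ‖v‖ ^ 2 ≤ A v v)
    (hC : ∀ v w, C v w = C w v) (hC' : ∀ v w, inner ℝ (C v v) (C w w) = ‖C v w‖ ^ 2) (a : V) :
    StronglyAbove (quarticEnergy S A C F a) (quarticGradient S A C F a) (m / 2) := by
  intro p q
  obtain ⟨h, rfl⟩ : ∃ h, q = p + h := ⟨q - p, by abel⟩
  have hSe : S (p + h - a) (p + h - a) = S (p - a) (p - a) + 2 * S (p - a) h + S h h := by
    rw [add_sub_right_comm]
    simp only [map_add, add_apply, hS h (p - a)]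
    ring
  have hAe : A (p + h) (p + h) = A p p + 2 * A p h + A h h := by
    simp only [map_add, add_apply, hA h p]
    ring
  have hCe : C (p + h) (p + h) = C p p + ((2 : ℝ) • C p h + C h h) := by
    simp only [map_add, add_apply, hC h p, two_smul]
    abel
  have hquart : ‖C (p + h) (p + h)‖ ^ 2 = ‖C p p‖ ^ 2 + 4 * inner ℝ (C p p) (C p h)
      + (2 * ‖C p h‖ ^ 2 + ‖(2 : ℝ) • C p h + C h h‖ ^ 2) := by
    rw [hCe, norm_add_sq_real, inner_add_right, inner_smul_right, hC']
    ring
  simp only [quarticEnergy, quarticGradient, add_sub_cancel_left, hSe, hAe, hquart]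
  simp only [map_add, add_apply, sub_apply, ContinuousLinearMap.comp_apply, innerSL_apply_apply]
  nlinarith [hS' h, hA' h, sq_nonneg ‖C p h‖, sq_nonneg ‖(2 : ℝ) • C p h + C h h‖]

/-- The cubic part is telescoped, one factor at a time, into terms linear in `v - u`; the two
remaining factors are bounded by `‖u‖ + R`. -/
lemma quarticGradient_lipschitz_on_ball (a u : V) (R : ℝ) :
    ∃ K, ∀ v, ‖v - u‖ ≤ R →
      ‖quarticGradient S A C F a v - quarticGradient S A C F a u‖ ≤ K * ‖v - u‖ := by
  refine ⟨‖S‖ + 3 * ‖C‖ ^ 2 * (‖u‖ + R) ^ 2 + ‖A‖, fun v hv => ?_⟩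
  have hR : 0 ≤ R := (norm_nonneg _).trans hv
  set ρ := ‖u‖ + R
  have hρ : 0 ≤ ρ := by positivity
  have hvρ : ‖v‖ ≤ ρ := by
    have := norm_le_norm_add_norm_sub' v u
    simp only [ρ]
    linarith
  have huρ : ‖u‖ ≤ ρ := le_add_of_nonneg_right hR
  set e := v - u with he
  have h1 : quarticGradient S A C F a v - quarticGradient S A C F a u
      = S e + (innerSL ℝ (C v v) ∘L C e + innerSL ℝ (C e v + C u e) ∘L C u) + A e := by
    ext w
    simp only [quarticGradient, he, map_sub, map_add, add_apply, sub_apply,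
      ContinuousLinearMap.comp_apply, innerSL_apply_apply]
    ring
  have h2 : ‖innerSL ℝ (C v v) ∘L C e‖ ≤ (‖C‖ * ρ * ρ) * (‖C‖ * ‖e‖) := by
    refine (ContinuousLinearMap.opNorm_comp_le _ _).trans ?_
    rw [innerSL_apply_norm]
    gcongr
    · exact (C.le_opNorm₂ v v).trans (by gcongr)
    · exact C.le_opNorm e
  have h3 : ‖innerSL ℝ (C e v + C u e) ∘L C u‖ ≤ (‖C‖ * ‖e‖ * ρ + ‖C‖ * ρ * ‖e‖) * (‖C‖ * ρ) := by
    refine (ContinuousLinearMap.opNorm_comp_le _ _).trans ?_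
    rw [innerSL_apply_norm]
    gcongr
    · exact (norm_add_le _ _).trans (add_le_add ((C.le_opNorm₂ e v).trans (by gcongr))
        ((C.le_opNorm₂ u e).trans (by gcongr)))
    · exact (C.le_opNorm u).trans (by gcongr)
  rw [h1]
  calc _ ≤ ‖S e‖ + (‖innerSL ℝ (C v v) ∘L C e‖ + ‖innerSL ℝ (C e v + C u e) ∘L C u‖) + ‖A e‖ := by
        refine norm_add₃_le.trans ?_
        gcongr
        exact norm_add_le _ _
    _ ≤ ‖S‖ * ‖e‖ + ((‖C‖ * ρ * ρ) * (‖C‖ * ‖e‖)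
        + (‖C‖ * ‖e‖ * ρ + ‖C‖ * ρ * ‖e‖) * (‖C‖ * ρ)) + ‖A‖ * ‖e‖ := by
        gcongr
        · exact S.le_opNorm e
        · exact A.le_opNorm e
    _ = _ := by ring

end QuarticEnergy

/-! ### The two nested iterations combined -/

section AbstractMethod

variable {V E : Type*} [NormedAddCommGroup V] [InnerProductSpace ℝ V] [CompleteSpace V]
  [NormedAddCommGroup E] [InnerProductSpace ℝ E]

/-- Well-posedness and convergence of perturbed preconditioned gradient descent with an inner
Richardson solver, for a coercive quartic energy on a Hilbert space. The number of inner iterations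
is a function of the current iterate. -/
theorem quartic_descent {gel A AM P : V →L[ℝ] StrongDual ℝ V} {C : V →L[ℝ] V →L[ℝ] E}
    {F : StrongDual ℝ V} {a : V} {G : V → ℝ} {w : ℝ → V → ℕ → V} {c m : ℝ}
    (hc : 0 < c) (hm : 0 < m) (hA : ∀ v w, A v w = A w v) (hA' : ∀ v, c * ‖v‖ ^ 2 ≤ A v v)
    (hAM : ∀ v, m * ‖v‖ ^ 2 ≤ AM v v)
    (hP : ∀ v w, P v w = P w v) (hP' : ∀ v, c * ‖v‖ ^ 2 ≤ P v v)
    (hS : ∀ v w, gel (AM.inverse (gel v)) w = gel (AM.inverse (gel w)) v)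
    (hS' : ∀ v, 0 ≤ gel (AM.inverse (gel v)) v)
    (hC : ∀ v w, C v w = C w v) (hC' : ∀ v w, inner ℝ (C v v) (C w w) = ‖C v w‖ ^ 2)
    (hG : ∀ v, G v = 1 / 2 * gel (AM.inverse (gel (v - a))) (v - a) + 1 / 4 * ‖C v v‖ ^ 2
      + 1 / 2 * A v v - F v)
    (hw : ∀ τ v n, w τ v (n + 1) = w τ v n + τ • A.inverse (gel (v - a) - AM (w τ v n))) (v₀ : V) :
    Differentiable ℝ G ∧ ∃ u : V, (∀ v, G u ≤ G v) ∧ (∀ u', (∀ v, G u' ≤ G v) → u' = u) ∧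
      ∀ ε : ℝ, 0 < ε → ∃ s₀ : ℝ, 0 < s₀ ∧ ∀ s : ℝ, 0 < s → s ≤ s₀ →
        ∃ (τ : ℝ) (N : V → ℕ), 0 < τ ∧ (∀ v, 0 < N v) ∧ ∀ T : V → V,
          (∀ v, T v = v - s • P.inverse
            (fderiv ℝ G v + gel (w τ v (N v) - AM.inverse (gel (v - a))))) →
          ∃ K : ℕ, ∀ k ≥ K, Real.sqrt (P (T^[k] v₀ - u) (T^[k] v₀ - u)) < ε := by
  set S : V →L[ℝ] StrongDual ℝ V := gel ∘L AM.inverse ∘L gel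
  obtain rfl : G = quarticEnergy S A C F a := funext hG
  have hderiv := fun v => hasFDerivAt_quarticEnergy (S := S) (F := F) hS hA hC a v
  have hstrong := stronglyAbove_quarticEnergy (S := S) (F := F) hS hS' hA hA' hC hC' a
  have hdiff : Differentiable ℝ (quarticEnergy S A C F a) := fun v => (hderiv v).differentiableAt
  obtain ⟨u, humin, huniq⟩ := hstrong.exists_unique_minimizer hdiff.continuous (by positivity)
  have hu0 : quarticGradient S A C F a u = 0 :=
    IsLocalMin.hasFDerivAt_eq_zero (Eventually.of_forall humin) (hderiv u)
  refine ⟨hdiff, u, humin, huniq, fun ε hε => ?_⟩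
  obtain ⟨τ, hτ, hrich⟩ := exists_richardson_step hc hA' hA hm hAM
  obtain ⟨s₀, hs₀, hconv⟩ := exists_perturbed_descent_converges hstrong (by positivity) hc hP' hP
    hu0 (fun R => by
      simpa only [hu0, sub_zero] using
        quarticGradient_lipschitz_on_ball (S := S) (A := A) (C := C) (F := F) a u R) v₀ hε
  refine ⟨s₀, hs₀, fun s hs hss => ?_⟩
  obtain ⟨δ, hδ, hδconv⟩ := hconv s hs hss
  -- The tolerance `δ` is known once `s` is, and the inner solver meets it from any starting point;
  -- the count depends on `v`, and large counts can be taken positive.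
  have hinner : ∀ v, ∃ n, 0 < n ∧ ‖gel (w τ v n - AM.inverse (gel (v - a)))‖ ≤ δ := by
    intro v
    have h1 := (hrich (gel (v - a)) (w τ v) (hw τ v)).sub_const (AM.inverse (gel (v - a)))
    have h2 := ((gel.continuous.tendsto _).comp h1).norm
    rw [sub_self, map_zero, norm_zero] at h2
    obtain ⟨n, hn, hn0⟩ := ((h2.eventually_lt_const hδ).and (eventually_gt_atTop 0)).exists
    exact ⟨n, hn0, hn.le⟩
  choose N hN0 hN using hinner
  refine ⟨τ, N, hτ, hN0, fun T hT => hδconv (fun k => T^[k] v₀) rfl fun k => ⟨_, hN (T^[k] v₀), ?_⟩⟩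
  simp only [Function.iterate_succ_apply', hT (T^[k] v₀), (hderiv _).fderiv]

end AbstractMethod

/-! ### Specialization to closed subspaces -/

section Submodule

variable {W E : Type*} [NormedAddCommGroup W] [InnerProductSpace ℝ W] (V : Submodule ℝ W)
  [CompleteSpace V] [NormedAddCommGroup E] [InnerProductSpace ℝ E]

lemma isInvertible_of_coercive_submodule {A : V →L[ℝ] StrongDual ℝ V} {c : ℝ} (hc : 0 < c)
    (h : ∀ v, c * ‖v‖ ^ 2 ≤ A v v) : A.IsInvertible :=
  isInvertible_of_coercive hc h

/-- `quartic_descent` for a closed subspace. Its instance arguments are the subspace ones, which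
makes it much cheaper to apply to `H1`. -/
theorem quartic_descent_submodule {gel A AM P : V →L[ℝ] StrongDual ℝ V} {C : V →L[ℝ] V →L[ℝ] E}
    {F : StrongDual ℝ V} {a : V} {G : V → ℝ} {w : ℝ → V → ℕ → V} {c m : ℝ}
    (hc : 0 < c) (hm : 0 < m) (hA : ∀ v w, A v w = A w v) (hA' : ∀ v, c * ‖v‖ ^ 2 ≤ A v v)
    (hAM : ∀ v, m * ‖v‖ ^ 2 ≤ AM v v)
    (hP : ∀ v w, P v w = P w v) (hP' : ∀ v, c * ‖v‖ ^ 2 ≤ P v v)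
    (hS : ∀ v w, gel (AM.inverse (gel v)) w = gel (AM.inverse (gel w)) v)
    (hS' : ∀ v, 0 ≤ gel (AM.inverse (gel v)) v)
    (hC : ∀ v w, C v w = C w v) (hC' : ∀ v w, inner ℝ (C v v) (C w w) = ‖C v w‖ ^ 2)
    (hG : ∀ v, G v = 1 / 2 * gel (AM.inverse (gel (v - a))) (v - a) + 1 / 4 * ‖C v v‖ ^ 2
      + 1 / 2 * A v v - F v)
    (hw : ∀ τ v n, w τ v (n + 1) = w τ v n + τ • A.inverse (gel (v - a) - AM (w τ v n))) (v₀ : V) :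
    Differentiable ℝ G ∧ ∃ u : V, (∀ v, G u ≤ G v) ∧ (∀ u', (∀ v, G u' ≤ G v) → u' = u) ∧
      ∀ ε : ℝ, 0 < ε → ∃ s₀ : ℝ, 0 < s₀ ∧ ∀ s : ℝ, 0 < s → s ≤ s₀ →
        ∃ (τ : ℝ) (N : V → ℕ), 0 < τ ∧ (∀ v, 0 < N v) ∧ ∀ T : V → V,
          (∀ v, T v = v - s • P.inverse
            (fderiv ℝ G v + gel (w τ v (N v) - AM.inverse (gel (v - a))))) →
          ∃ K : ℕ, ∀ k ≥ K, Real.sqrt (P (T^[k] v₀ - u) (T^[k] v₀ - u)) < ε :=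
  quartic_descent hc hm hA hA' hAM hP hP' hS hS' hC hC' hG hw v₀

end Submodule

/-! ### Application to the Cahn–Hilliard energy -/

section Main

variable {d : ℕ} {ℓ : ℝ}

lemma energy_eq {M : Linf d ℓ} (hS : ∀ v, 0 ≤ gelfand ((negLapM M).inverse (gelfand v)) v)
    (f : L2 d ℓ) (uStar : H1 d ℓ) {J : H1 d ℓ →L[ℝ] Lp ℝ 4 (cellMeasure d ℓ)}
    (hJ : ∀ v, ∀ᵐ x ∂(cellMeasure d ℓ), J v x = toL2 v x) (v : H1 d ℓ) :
    energy M f uStar v =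
      1 / 2 * gelfand ((negLapM M).inverse (gelfand (v - uStar))) (v - uStar)
        + 1 / 4 * ‖(mulL4 d ℓ).bilinearComp J J v v‖ ^ 2 + 1 / 2 * negLap v v
        - (innerSL ℝ f ∘L toL2) v := by
  have h1 : normNegM M (v - uStar) ^ 2
      = gelfand ((negLapM M).inverse (gelfand (v - uStar))) (v - uStar) := Real.sq_sqrt (hS _)
  have h2 : ∫ x, |toL2 v x| ^ 4 ∂(cellMeasure d ℓ) = ‖mulL4 d ℓ (J v) (J v)‖ ^ 2 := by
    rw [norm_mulL4_self_sq]
    refine integral_congr_ae ?_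
    filter_upwards [hJ v] with x hx
    rw [hx]
  have h3 : ‖(mulL4 d ℓ).bilinearComp J J v v‖ = ‖mulL4 d ℓ (J v) (J v)‖ := rfl
  have h4 : (innerSL ℝ f ∘L toL2) v = inner ℝ f (toL2 v) := rfl
  simp only [energy, h1, h2, h3, h4, negLap_self]

/-- The method with a constant inner step size and the number of inner iterations chosen from the
current iterate is an autonomous iteration. -/
lemma ppgd_eq_iterate (M : Linf d ℓ) (f : L2 d ℓ) (uStar : H1 d ℓ) (lam γ s τ : ℝ) (v₀ : H1 d ℓ)
    (N : H1 d ℓ → ℕ) {T : H1 d ℓ → H1 d ℓ}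
    (hT : ∀ v, T v = v - s • (precond lam γ).inverse
      (fderiv ℝ (energy M f uStar) v + perturbation M uStar v (v, τ, N v))) (k : ℕ) :
    ppgd M f uStar lam γ s v₀ (fun _ => τ) (fun j => N (T^[j] v₀)) k = T^[k] v₀ := by
  induction k with
  | zero => simp only [ppgd, Function.iterate_zero, id]
  | succ k ih =>
    rw [Function.iterate_succ_apply', hT]
    simp only [ppgd, ih]

end Main

end CahnHilliard
end

open CahnHilliard

set_option maxHeartbeats 1000000 in
theorem theorem4p2 (d : ℕ) (hd : d = 2 ∨ d = 3) (ℓ : ℝ) (hℓ : 0 < ℓ)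
    (M : Linf d ℓ) (M₁ M₂ : ℝ) (hM₁ : 0 < M₁)
    (hM : ∀ᵐ x ∂(cellMeasure d ℓ), M₁ ≤ M x ∧ M x ≤ M₂)
    (f : L2 d ℓ) (uStar : H1 d ℓ) (lam γ : ℝ) (hlam : 0 < lam) (hγ : 0 ≤ γ) (v₀ : H1 d ℓ) :
    -- the setting is well posed
    (negLap : H1 d ℓ →L[ℝ] Hneg d ℓ).IsInvertible ∧
    (negLapM M).IsInvertible ∧
    (precond lam γ : H1 d ℓ →L[ℝ] Hneg d ℓ).IsInvertible ∧
    (∀ v : H1 d ℓ, MemLp (toL2 v) 4 (cellMeasure d ℓ)) ∧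
    Differentiable ℝ (energy M f uStar) ∧
    -- `u` is the unique minimizer of the energy, and the method converges to it
    ∃ u : H1 d ℓ,
      (∀ v, energy M f uStar u ≤ energy M f uStar v) ∧
      (∀ u', (∀ v, energy M f uStar u' ≤ energy M f uStar v) → u' = u) ∧
      ∀ ε > 0, ∃ s₀ > 0, ∀ s, 0 < s → s ≤ s₀ →
        ∃ (K : ℕ) (τ : ℕ → ℝ) (N : ℕ → ℕ), (∀ k, 0 < τ k ∧ 0 < N k) ∧
          ∀ k ≥ K, normL lam γ (ppgd M f uStar lam γ s v₀ τ N k - u) < ε := by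
  have hd4 : d < 4 := by omega
  obtain ⟨c, hc, hgrad⟩ := exists_gradient_coercive d hℓ
  have hlap : ∀ v : H1 d ℓ, c * ‖v‖ ^ 2 ≤ negLap v v := fun v => by
    rw [negLap_self]; exact hgrad v
  have hlapM : ∀ v : H1 d ℓ, M₁ * c * ‖v‖ ^ 2 ≤ negLapM M v v := fun v => by
    refine le_trans ?_ (le_negLapM_self (hM.mono fun x hx => hx.1) v)
    rw [mul_assoc]
    exact mul_le_mul_of_nonneg_left (hgrad v) hM₁.le
  have hm : 0 < M₁ * c := mul_pos hM₁ hc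
  have hinv := isInvertible_of_coercive_submodule (H1 d ℓ) hc hlap
  have hinvM := isInvertible_of_coercive_submodule (H1 d ℓ) hm hlapM
  have hpre : ∀ v : H1 d ℓ, c * ‖v‖ ^ 2 ≤ precond lam γ v v := fun v =>
    (hlap v).trans (negLap_le_precond hinv hlam.le hγ v)
  have hinvP := isInvertible_of_coercive_submodule (H1 d ℓ) hc hpre
  obtain ⟨J, hJ⟩ := exists_toL4 hd4 hℓ
  have hS' : ∀ v, 0 ≤ gelfand ((negLapM M).inverse (gelfand v)) v :=
    gelfand_inverse_self_nonneg hinvM fun v =>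
      (mul_nonneg hm.le (sq_nonneg ‖v‖)).trans (hlapM v)
  have key := @quartic_descent_submodule _ (L2 d ℓ) _ _ (H1 d ℓ) _ _ _ gelfand negLap (negLapM M)
    (precond lam γ) ((mulL4 d ℓ).bilinearComp J J) (innerSL ℝ f ∘L toL2) uStar (energy M f uStar)
    (fun τ v n => innerPGD M (gelfand (v - uStar)) v τ n) c (M₁ * c)
  obtain ⟨hdiff, u, humin, huniq, hconv⟩ := key hc hm negLap_symm hlap hlapM
    (precond_symm hinv lam γ) hpre (gelfand_inverse_symm hinvM (negLapM_symm M)) hS'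
    (fun v w => mulL4_symm (J v) (J w)) (fun v w => inner_mulL4_sq_sq (J v) (J w))
    (energy_eq hS' f uStar hJ) (fun τ v n => by simp only [innerPGD]) v₀
  refine ⟨hinv, hinvM, hinvP, memLp_four_toL2 hd4 hℓ, hdiff, u, humin, huniq, fun ε hε => ?_⟩
  obtain ⟨s₀, hs₀, hs⟩ := hconv ε hε
  refine ⟨s₀, hs₀, fun s hs0 hss => ?_⟩
  obtain ⟨τ, N, hτ, hN, hT⟩ := hs s hs0 hss
  obtain ⟨T, hTdef⟩ : ∃ T : H1 d ℓ → H1 d ℓ, ∀ v, T v = v - s • (precond lam γ).inverse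
      (fderiv ℝ (energy M f uStar) v + perturbation M uStar v (v, τ, N v)) := ⟨_, fun _ => rfl⟩
  obtain ⟨K, hK⟩ := hT T fun v => by rw [hTdef, perturbation, approxInv]
  -- The inner step size is constant; the inner iteration count is read off the current outer
  -- iterate.
  refine ⟨K, fun _ => τ, fun j => N (T^[j] v₀), fun k => ⟨hτ, hN _⟩, fun k hk => ?_⟩
  rw [ppgd_eq_iterate M f uStar lam γ s τ v₀ N hTdef]
  exact hK k hk
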